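/- Throughout, Hilbert spaces are complex, $q$ is a complex number with $|q|=1$, and for a contraction $T$ on a Hilbert space, $D_T=(I-T^*T)^{1/2}$ and $\mathcal D_T=\overline{\operatorname{Ran}}\,D_T$. Let $\mathcal H$ be a Hilbert space, let $T_1,T_2$ be contractions on $\mathcal H$ with $T_1T_2=q\,T_2T_1$, and put $T=T_1T_2$. For a Hilbert space $\mathcal F$, $H^2(\mathcal F)$ is the Hardy space of power series $f(z)=\sum_{n\ge 0} z^n a_n$ on the unit disc, $a_n\in\mathcal F$, $\|f\|^2=\sum_n\|a_n\|^2<\infty$; on it let $\mathbf{ev}_0 f=f(0)$, $(R_qf)(z)=f(qz)$, and $(M_\varphi f)(z)=\varphi(z)f(z)$. An Andô tuple $(\mathcal F;\Lambda,P,U)$ of $(T_1,T_2)$ consists of a Hilbert space $\mathcal F$, an isometry $\Lambda:\mathcal D_T\to\mathcal F$, an orthogonal projection $P$ and a unitary $U$ on $\mathcal F$; write $P^\perp=I-P$. To such a tuple associate the operators on $\mathcal H\oplus H^2(\mathcal F)$ $$V_1^S=\begin{bmatrix} T_1&0\\ \mathbf{ev}_0^*PU\Lambda D_T& q\,M_{(P^\perp+zP)U}R_q\end{bmatrix},\qquad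 V_2^S=\begin{bmatrix} T_2&0\\ \overline q\,\mathbf{ev}_0^*U^*P^\perp\Lambda D_T&\overline q\,R_{\overline q}M_{U^*(P+zP^\perp)}\end{bmatrix}.$$ The tuple is special if $\mathcal F=\mathcal D_{T_1}\oplus\mathcal D_{T_2}\oplus\mathcal E$ for some (possibly zero) Hilbert space $\mathcal E$, $P$ is the orthogonal projection of $\mathcal F$ onto $\mathcal D_{T_1}\oplus 0\oplus 0$, and for all $h\in\mathcal H$ $$\Lambda D_Th=D_{T_1}T_2h\oplus D_{T_2}h\oplus 0,\qquad U(D_{T_1}T_2h\oplus D_{T_2}h\oplus0)=D_{T_1}h\oplus D_{T_2}T_1h\oplus 0 .$$ A $q$-commuting isometric lift of $(T_1,T_2)$ is a pair of isometries $(V_1,V_2)$ with $V_1V_2=qV_2V_1$ on a Hilbert space $\mathcal K$ containing $\mathcal H$ as a closed subspace (via an isometric embedding) such that $V_j^*|_{\mathcal H}=T_j^*$ for $j=1,2$; it is minimal if $\mathcal K$ is the closed linear span of all $V_1^mV_2^nh$ with $m,n\ge0$ and $h\in\mathcal H$. Consider the relations $$T_1^*T_1+D_T\Lambda^*U^*PU\Lambda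 D_T=I,\qquad T_2^*T_2+D_T\Lambda^*P^\perp\Lambda D_T=I,$$ $$PU\Lambda D_TT_2+P^\perp\Lambda D_T=\Lambda D_T=U^*(P^\perp\Lambda D_TT_1+PU\Lambda D_T).\tag{R}$$ Theorem. (1) For every special Andô tuple $(\mathcal F;\Lambda,P,U)$ of $(T_1,T_2)$, the pair $(V_1^S,V_2^S)$ is a $q$-commuting isometric lift of $(T_1,T_2)$, with $\mathcal H$ embedded as $\mathcal H\oplus 0$, and the tuple satisfies the relations (R). (2) Conversely, if $(V_1,V_2)$ on $\mathcal K$ is a minimal $q$-commuting isometric lift of $(T_1,T_2)$, then there are an Andô tuple $(\mathcal F;\Lambda,P,U)$ of $(T_1,T_2)$ that satisfies the relations (R), and a unitary $\tau:\mathcal K\to\mathcal H\oplus H^2(\mathcal F)$ with $\tau h=h\oplus0$ for $h\in\mathcal H$ and $\tau V_j=V_j^S\tau$ for $j=1,2$, where $(V_1^S,V_2^S)$ is the pair associated with this tuple. -/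

import Mathlib

open scoped ComplexConjugate

universe u v w

noncomputable section

namespace QCommuting

open ContinuousLinearMap

/-! ### Defect operators and defect spaces -/

section Defect

variable {H : Type u} [NormedAddCommGroup H] [InnerProductSpace ℂ H] [CompleteSpace H]

/-- The defect operator `D_T = (I - T* T)^{1/2}` of a contraction `T`. -/
def defectOp (T : H →L[ℂ] H) : H →L[ℂ] H := CFC.sqrt (1 - adjoint T * T)

/-- The defect space `𝒟_T`, the closure of the range of `D_T`. -/
abbrev defectSpace (T : H →L[ℂ] H) : Submodule ℂ H := (defectOp T).range.topologicalClosure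

theorem defectOp_mem (T : H →L[ℂ] H) (h : H) : defectOp T h ∈ defectSpace T :=
  Submodule.le_topologicalClosure _ ⟨h, rfl⟩

/-- `D_T` regarded as an operator from `H` into `𝒟_T`. -/
def defectMap (T : H →L[ℂ] H) : H →L[ℂ] defectSpace T :=
  (defectOp T).codRestrict (defectSpace T) (defectOp_mem T)

end Defect

/-! ### The vector-valued Hardy space `H²(F)` -/

section Hardy

set_option linter.unusedSectionVars false

variable (F : Type v) [NormedAddCommGroup F] [InnerProductSpace ℂ F]

/-- The Hardy space `H²(F)` of the unit disc: the power series `∑ zⁿ aₙ` with coefficients in `F`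
and `∑ ‖aₙ‖² < ∞`, given by their coefficient sequences, with norm `(∑ ‖aₙ‖²)^{1/2}`. -/
abbrev Hardy : Type v := lp (fun _ : ℕ => F) 2

variable {F}

/-- The value `f(z) = ∑ zⁿ aₙ` at a point `z`; the series converges for `|z| < 1`, see
`Hardy.hasSum_eval`. -/
def Hardy.eval (f : Hardy F) (z : ℂ) : F := ∑' n, z ^ n • f n

/-- Evaluation at zero, `f ↦ f(0)`. -/
def Hardy.ev0 : Hardy F →L[ℂ] F := lp.evalCLM ℂ (fun _ : ℕ => F) (p := 2) 0

/-- A coefficientwise bounded sequence of operators acts on `H²(F)`. -/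
theorem Hardy.memlp_of_le {a : ℕ → F} (f : Hardy F) (C : ℝ) (h : ∀ n, ‖a n‖ ≤ C * ‖f n‖) :
    Memℓp a 2 := by
  have hf := (lp.memℓp f).summable (by norm_num)
  refine memℓp_gen ((hf.mul_left (C ^ 2)).of_nonneg_of_le (fun n => by positivity) fun n => ?_)
  have := pow_le_pow_left₀ (norm_nonneg _) (h n) 2
  simpa [mul_pow] using this

theorem Hardy.norm_le_of_le (a f : Hardy F) (C : ℝ) (hC : 0 ≤ C) (h : ∀ n, ‖a n‖ ≤ C * ‖f n‖) :
    ‖a‖ ≤ C * ‖f‖ := by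
  refine lp.norm_le_of_forall_sum_le (by norm_num) (by positivity) fun s => ?_
  have hs := lp.sum_rpow_le_norm_rpow (p := 2) (by norm_num) f s
  simp only [ENNReal.toReal_ofNat, Real.rpow_ofNat] at hs ⊢
  calc ∑ n ∈ s, ‖a n‖ ^ 2 ≤ ∑ n ∈ s, C ^ 2 * ‖f n‖ ^ 2 :=
        Finset.sum_le_sum fun n _ => by
          simpa [mul_pow] using pow_le_pow_left₀ (norm_nonneg _) (h n) 2
    _ = C ^ 2 * ∑ n ∈ s, ‖f n‖ ^ 2 := by rw [Finset.mul_sum]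
    _ ≤ (C * ‖f‖) ^ 2 := by rw [mul_pow]; gcongr

/-- The operator `f ↦ (z ↦ A (f z))` on `H²(F)`, multiplication by a constant operator `A`. -/
def Hardy.mulConst (A : F →L[ℂ] F) : Hardy F →L[ℂ] Hardy F :=
  LinearMap.mkContinuous
    { toFun := fun f => ⟨fun n => A (f n), Hardy.memlp_of_le f ‖A‖ fun n => A.le_opNorm _⟩
      map_add' := fun f g => by ext n; exact map_add A (f n) (g n)
      map_smul' := fun c f => by ext n; exact map_smul A c (f n) }
    ‖A‖ fun f => Hardy.norm_le_of_le _ f ‖A‖ (norm_nonneg _) fun n => A.le_opNorm _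

/-- The coefficient sequence of `z f(z)`. -/
def Hardy.shiftSeq (a : ℕ → F) : ℕ → F
  | 0 => 0
  | n + 1 => a n

theorem Hardy.shiftSeq_hasSum (f : Hardy F) :
    HasSum (fun n => ‖Hardy.shiftSeq f n‖ ^ (2 : ENNReal).toReal)
      (‖f‖ ^ (2 : ENNReal).toReal) := by
  have hf := lp.hasSum_norm (p := 2) (by norm_num) f
  refine (hasSum_nat_add_iff' 1).mp ?_
  simpa [Hardy.shiftSeq] using hf

/-- The shift `M_z : f ↦ (z ↦ z f(z))` on `H²(F)`. -/
def Hardy.shift : Hardy F →L[ℂ] Hardy F :=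
  LinearMap.mkContinuous
    { toFun := fun f => ⟨Hardy.shiftSeq f, memℓp_gen (Hardy.shiftSeq_hasSum f).summable⟩
      map_add' := fun f g => by
        ext n
        cases n with
        | zero => exact (add_zero (0 : F)).symm
        | succ n => rfl
      map_smul' := fun c f => by ext n; cases n <;> simp [Hardy.shiftSeq] }
    1 fun f => by
      rw [one_mul]
      exact lp.norm_le_of_tsum_le (by norm_num) (norm_nonneg _) (Hardy.shiftSeq_hasSum f).tsum_eq.le

/-- The multiplication operator `M_φ` on `H²(F)` with symbol the operator-valued polynomial
`φ(z) = A + zB`; see `Hardy.eval_mulPencil`. -/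
def Hardy.mulPencil (A B : F →L[ℂ] F) : Hardy F →L[ℂ] Hardy F :=
  Hardy.mulConst A + Hardy.shift ∘L Hardy.mulConst B

/-- The rotation operator `(R_q f)(z) = f(qz)` on `H²(F)`, `|q| = 1`; see
`Hardy.eval_rotation`. -/
def Hardy.rotation (q : Circle) : Hardy F →L[ℂ] Hardy F :=
  LinearMap.mkContinuous
    { toFun := fun f => ⟨fun n => (q : ℂ) ^ n • f n,
        Hardy.memlp_of_le f 1 fun n => by simp [norm_smul, Circle.norm_coe]⟩
      map_add' := fun f g => by ext n; exact smul_add _ (f n) (g n)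
      map_smul' := fun c f => by ext n; exact smul_comm _ c (f n) }
    1 fun f => Hardy.norm_le_of_le _ f 1 zero_le_one fun n => by simp [norm_smul, Circle.norm_coe]

/-! The next facts identify the elements of `H²(F)` with functions on the disc, and the operators
above with the operators on functions that they stand for. -/

theorem Hardy.hasSum_eval [CompleteSpace F] (f : Hardy F) {z : ℂ} (hz : ‖z‖ < 1) :
    HasSum (fun n => z ^ n • f n) (f.eval z) := by
  refine Summable.hasSum (Summable.of_norm_bounded (g := fun n => ‖z‖ ^ n * ‖f‖)
    ((summable_geometric_of_lt_one (norm_nonneg _) hz).mul_right _) fun n => ?_)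
  rw [norm_smul, norm_pow]
  gcongr
  exact lp.norm_apply_le_norm (by norm_num) f n

theorem Hardy.eval_zero (f : Hardy F) : f.eval 0 = Hardy.ev0 f := by
  rw [Hardy.eval, tsum_eq_single 0 (fun n hn => by simp [hn])]
  simp [Hardy.ev0, lp.evalCLM]

theorem Hardy.eval_mulPencil [CompleteSpace F] (A B : F →L[ℂ] F) (f : Hardy F) {z : ℂ}
    (hz : ‖z‖ < 1) : (Hardy.mulPencil A B f).eval z = (A + z • B) (f.eval z) := by
  have hf := f.hasSum_eval hz
  have hA : HasSum (fun n => z ^ n • A (f n)) (A (f.eval z)) := by simpa using hf.mapL A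
  have hB : HasSum (fun n => z ^ n • Hardy.shiftSeq (fun k => B (f k)) n) (z • B (f.eval z)) := by
    refine (hasSum_nat_add_iff' 1).mp ?_
    simpa [Hardy.shiftSeq, pow_succ', mul_smul] using (hf.mapL B).const_smul z
  have := hA.add hB
  simp only [← smul_add] at this
  exact this.tsum_eq

theorem Hardy.eval_rotation (q : Circle) (f : Hardy F) (z : ℂ) :
    (Hardy.rotation q f).eval z = f.eval (q * z) := by
  refine tsum_congr fun n => ?_
  change z ^ n • (q : ℂ) ^ n • f n = _
  rw [smul_smul, ← mul_pow, mul_comm]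

end Hardy

/-! ### Lifts -/

section Lifts

variable {H : Type u} [NormedAddCommGroup H] [InnerProductSpace ℂ H] [CompleteSpace H]
variable {K : Type v} [NormedAddCommGroup K] [InnerProductSpace ℂ K] [CompleteSpace K]

/-- `(T₁, T₂)` is `q`-commuting: `T₁ T₂ = q T₂ T₁`. -/
def IsQCommuting (q : Circle) (T₁ T₂ : H →L[ℂ] H) : Prop := T₁ * T₂ = (q : ℂ) • (T₂ * T₁)

/-- `(V₁, V₂)` on `K` is a `q`-commuting isometric lift of `(T₁, T₂)` on `H`, where `H` is regarded
as a subspace of `K` through the isometric embedding `i`: both `Vⱼ` are isometries, the pair is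
`q`-commuting, and `Vⱼ*` restricted to `H` is `Tⱼ*`. -/
structure IsIsometricLift (q : Circle) (T₁ T₂ : H →L[ℂ] H) (i : H →ₗᵢ[ℂ] K)
    (V₁ V₂ : K →L[ℂ] K) : Prop where
  isometry₁ : Isometry V₁
  isometry₂ : Isometry V₂
  q_commuting : IsQCommuting q V₁ V₂
  lift₁ : ∀ h, adjoint V₁ (i h) = i (adjoint T₁ h)
  lift₂ : ∀ h, adjoint V₂ (i h) = i (adjoint T₂ h)

/-- The lift is minimal: `K` is the closed linear span of all `V₁ᵐ V₂ⁿ h` with `h ∈ H`. -/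
def IsMinimalLift (i : H →ₗᵢ[ℂ] K) (V₁ V₂ : K →L[ℂ] K) : Prop :=
  (Submodule.span ℂ {x : K | ∃ (m n : ℕ) (h : H), x = (V₁ ^ m) ((V₂ ^ n) (i h))}).topologicalClosure
    = ⊤

end Lifts

/-! ### Andô tuples -/

section Ando

variable {H : Type u} [NormedAddCommGroup H] [InnerProductSpace ℂ H] [CompleteSpace H]
variable {F : Type v} [NormedAddCommGroup F] [InnerProductSpace ℂ F] [CompleteSpace F]

/-- A tuple `(F; Λ, P, U)` attached to `T = T₁ T₂`: an isometry `Λ : 𝒟_T → F`, an orthogonal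
projection `P` on `F`, and a unitary `U` on `F`. -/
structure AndoTuple (T₁ T₂ : H →L[ℂ] H) (F : Type v) [NormedAddCommGroup F]
    [InnerProductSpace ℂ F] [CompleteSpace F] where
  Λ : defectSpace (T₁ * T₂) →ₗᵢ[ℂ] F
  P : F →L[ℂ] F
  isStarProjection_P : IsStarProjection P
  U : F ≃ₗᵢ[ℂ] F

namespace AndoTuple

variable {T₁ T₂ : H →L[ℂ] H} (A : AndoTuple T₁ T₂ F)

/-- The unitary `U` as a bounded operator. -/
def Uop : F →L[ℂ] F := A.U.toContinuousLinearEquiv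

/-- The operator `Λ D_T : H → F`. -/
def ΛD : H →L[ℂ] F := A.Λ.toContinuousLinearMap ∘L defectMap (T₁ * T₂)

/-- The operator `D_T Λ* : F → H`. -/
def DΛadj : F →L[ℂ] H :=
  defectOp (T₁ * T₂) ∘L (defectSpace (T₁ * T₂)).subtypeL ∘L adjoint A.Λ.toContinuousLinearMap

/-- The complementary projection `P^⊥ = I - P`. -/
def Pperp : F →L[ℂ] F := 1 - A.P

/-- The relations
`T₁* T₁ + D_T Λ* U* P U Λ D_T = I`, `T₂* T₂ + D_T Λ* P^⊥ Λ D_T = I`,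
`P U Λ D_T T₂ + P^⊥ Λ D_T = Λ D_T = U* (P^⊥ Λ D_T T₁ + P U Λ D_T)`. -/
structure Relations : Prop where
  rel₁ : adjoint T₁ ∘L T₁ + A.DΛadj ∘L adjoint A.Uop ∘L A.P ∘L A.Uop ∘L A.ΛD = 1
  rel₂ : adjoint T₂ ∘L T₂ + A.DΛadj ∘L A.Pperp ∘L A.ΛD = 1
  rel₃ : A.P ∘L A.Uop ∘L A.ΛD ∘L T₂ + A.Pperp ∘L A.ΛD = A.ΛD
  rel₄ : A.ΛD = adjoint A.Uop ∘L (A.Pperp ∘L A.ΛD ∘L T₁ + A.P ∘L A.Uop ∘L A.ΛD)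

end AndoTuple

/-- The space `𝒟_{T₁} ⊕ 𝒟_{T₂} ⊕ E` (Hilbert space direct sum). -/
abbrev AndoSpace (T₁ T₂ : H →L[ℂ] H) (E : Type w) [NormedAddCommGroup E]
    [InnerProductSpace ℂ E] : Type (max u w) :=
  WithLp 2 (defectSpace T₁ × WithLp 2 (defectSpace T₂ × E))

/-- The vector `x ⊕ y ⊕ e` of `𝒟_{T₁} ⊕ 𝒟_{T₂} ⊕ E`. -/
def AndoSpace.mk {T₁ T₂ : H →L[ℂ] H} {E : Type w} [NormedAddCommGroup E]
    [InnerProductSpace ℂ E] (x : defectSpace T₁) (y : defectSpace T₂) (e : E) :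
    AndoSpace T₁ T₂ E :=
  WithLp.toLp 2 (x, WithLp.toLp 2 (y, e))

/-- `(F; Λ, P, U)` is a special Andô tuple of `(T₁, T₂)`: `F = 𝒟_{T₁} ⊕ 𝒟_{T₂} ⊕ E`, the isometry
`Λ` is given by `Λ D_T h = D_{T₁} T₂ h ⊕ D_{T₂} h ⊕ 0`, `P` is the orthogonal projection onto
`𝒟_{T₁} ⊕ 0 ⊕ 0`, and `U` is a unitary with
`U (D_{T₁} T₂ h ⊕ D_{T₂} h ⊕ 0) = D_{T₁} h ⊕ D_{T₂} T₁ h ⊕ 0`. -/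
structure AndoTuple.IsSpecial {T₁ T₂ : H →L[ℂ] H} {E : Type w} [NormedAddCommGroup E]
    [InnerProductSpace ℂ E] [CompleteSpace E] (A : AndoTuple T₁ T₂ (AndoSpace T₁ T₂ E)) :
    Prop where
  Λ_apply : ∀ h, A.Λ (defectMap (T₁ * T₂) h) =
    AndoSpace.mk (defectMap T₁ (T₂ h)) (defectMap T₂ h) 0
  P_apply : ∀ x y e, A.P (AndoSpace.mk x y e) = AndoSpace.mk x 0 0
  U_apply : ∀ h, A.U (AndoSpace.mk (defectMap T₁ (T₂ h)) (defectMap T₂ h) 0) =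
    AndoSpace.mk (defectMap T₁ h) (defectMap T₂ (T₁ h)) 0

end Ando

/-! ### The Schäffer-type model -/

section Model

variable {H : Type u} [NormedAddCommGroup H] [InnerProductSpace ℂ H] [CompleteSpace H]
variable {F : Type v} [NormedAddCommGroup F] [InnerProductSpace ℂ F] [CompleteSpace F]

/-- The `2 × 2` block operator `[X 0; Y Z]` on `H ⊕ G`. -/
def lowerBlock {G : Type v} [NormedAddCommGroup G] [InnerProductSpace ℂ G]
    (X : H →L[ℂ] H) (Y : H →L[ℂ] G) (Z : G →L[ℂ] G) :
    WithLp 2 (H × G) →L[ℂ] WithLp 2 (H × G) :=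
  (WithLp.prodContinuousLinearEquiv 2 ℂ H G).symm.toContinuousLinearMap ∘L
    ((X ∘L WithLp.fstL 2 ℂ H G).prod (Y ∘L WithLp.fstL 2 ℂ H G + Z ∘L WithLp.sndL 2 ℂ H G))

/-- The inclusion `h ↦ h ⊕ 0` of `H` into `H ⊕ G`. -/
def inclusion (H : Type u) [NormedAddCommGroup H] [InnerProductSpace ℂ H]
    (G : Type v) [NormedAddCommGroup G] [InnerProductSpace ℂ G] :
    H →ₗᵢ[ℂ] WithLp 2 (H × G) where
  toFun h := WithLp.toLp 2 (h, 0)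
  map_add' x y := by rw [← WithLp.toLp_add]; simp
  map_smul' c x := by rw [← WithLp.toLp_smul]; simp
  norm_map' x := by simp

/-- The first model operator
`V₁ˢ = [T₁ 0; ev₀* P U Λ D_T, q M_{(P^⊥ + zP)U} R_q]` on `H ⊕ H²(F)`. -/
def schaffer₁ (q : Circle) {T₁ T₂ : H →L[ℂ] H} (A : AndoTuple T₁ T₂ F) :
    WithLp 2 (H × Hardy F) →L[ℂ] WithLp 2 (H × Hardy F) :=
  lowerBlock T₁ (adjoint Hardy.ev0 ∘L A.P ∘L A.Uop ∘L A.ΛD)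
    ((q : ℂ) • (Hardy.mulPencil (A.Pperp ∘L A.Uop) (A.P ∘L A.Uop) ∘L Hardy.rotation q))

/-- The second model operator
`V₂ˢ = [T₂ 0; q̄ ev₀* U* P^⊥ Λ D_T, q̄ R_{q̄} M_{U*(P + zP^⊥)}]` on `H ⊕ H²(F)`; here `q̄ = q⁻¹`. -/
def schaffer₂ (q : Circle) {T₁ T₂ : H →L[ℂ] H} (A : AndoTuple T₁ T₂ F) :
    WithLp 2 (H × Hardy F) →L[ℂ] WithLp 2 (H × Hardy F) :=
  lowerBlock T₂ (conj (q : ℂ) • (adjoint Hardy.ev0 ∘L adjoint A.Uop ∘L A.Pperp ∘L A.ΛD))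
    (conj (q : ℂ) • (Hardy.rotation q⁻¹ ∘L
      Hardy.mulPencil (adjoint A.Uop ∘L A.P) (adjoint A.Uop ∘L A.Pperp)))

end Model

end QCommuting

end

open scoped ComplexConjugate

set_option linter.unusedSectionVars false

noncomputable section

namespace QCommuting

open ContinuousLinearMap

/-! ### Defect operators -/

section Defect

variable {H : Type u} [NormedAddCommGroup H] [InnerProductSpace ℂ H] [CompleteSpace H]

/-! Everything rests on the relations (R), read on vectors as `VectorRelations`: two norm identities
and two decompositions.

For (1), a special tuple satisfies them because `‖D_T h‖² = ‖h‖² - ‖T h‖²` and `P` cuts `U Λ D_T h`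
and `Λ D_T h` into the two defect components. Conversely (R) makes the model work. The norm
identities give the first columns of the blocks the right norm, the orthogonality of `P` and `P^⊥`
does the rest of isometry, and the two decompositions make `V₁ˢ V₂ˢ` and `q V₂ˢ V₁ˢ` both equal to
the Schäffer form `[T 0; ev₀* Λ D_T, M_z]`. The lift condition is lower triangularity.

For (2), the restrictions `W₁, W₂` of the lift to the complement of `H` are `q`-commuting
isometries. Minimality makes `W = W₁ W₂` pure, so by Wold the complement is `H²(ker W*)` with `W` as
the shift. A `q`-version of the Berger–Coburn–Lebow theorem writes `W₁, W₂` through the projection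
`P = 1 - W₁ W₁*` and a unitary `U` of `ker W*`. The vectors `V₁ V₂ h - T h` lie in `ker W*` and have
norm `‖D_T h‖`, which defines `Λ`. Comparing the off-diagonal entries of `V₁`, `V₂` and `V₁ V₂` then
yields (R) and the model. -/

theorem one_sub_adjoint_mul_self_nonneg {T : H →L[ℂ] H} (hT : ‖T‖ ≤ 1) :
    0 ≤ 1 - adjoint T * T := by
  rw [nonneg_iff_isPositive, isPositive_def']
  refine ⟨?_, fun x => ?_⟩
  · exact (IsSelfAdjoint.one _).sub (IsSelfAdjoint.star_mul_self T)
  · have h1 : ‖T x‖ ≤ ‖x‖ := by simpa using T.le_of_opNorm_le hT x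
    have h2 : ‖T x‖ ^ 2 ≤ ‖x‖ ^ 2 := by gcongr
    rw [reApplyInnerSelf_apply]
    change 0 ≤ RCLike.re (inner ℂ (x - adjoint T (T x)) x)
    rw [inner_sub_left, adjoint_inner_left, map_sub, inner_self_eq_norm_sq, inner_self_eq_norm_sq]
    linarith

theorem norm_defectOp_sq {T : H →L[ℂ] H} (hT : ‖T‖ ≤ 1) (h : H) :
    ‖defectOp T h‖ ^ 2 = ‖h‖ ^ 2 - ‖T h‖ ^ 2 := by
  have h1 : defectOp T * defectOp T = 1 - adjoint T * T :=
    CFC.sqrt_mul_sqrt_self _ (one_sub_adjoint_mul_self_nonneg hT)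
  have h2 : adjoint (defectOp T) = defectOp T := (CFC.sqrt_nonneg _).isSelfAdjoint
  have h3 : inner ℂ (defectOp T h) (defectOp T h) = inner ℂ h h - inner ℂ (T h) (T h) := by
    have h4 : defectOp T (defectOp T h) = h - adjoint T (T h) := congr($h1 h)
    rw [← adjoint_inner_right, h2, h4, inner_sub_right, adjoint_inner_right]
  simp only [inner_self_eq_norm_sq_to_K] at h3
  exact_mod_cast h3

theorem norm_defectMap (T : H →L[ℂ] H) (h : H) : ‖defectMap T h‖ = ‖defectOp T h‖ := rfl

end Defect

/-! ### Coefficient calculus on the Hardy space -/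

section Hardy

variable {F : Type v} [NormedAddCommGroup F] [InnerProductSpace ℂ F]

namespace Hardy

theorem hasSum_norm_sq (f : Hardy F) : HasSum (fun n => ‖f n‖ ^ 2) (‖f‖ ^ 2) := by
  simpa using lp.hasSum_norm (p := 2) (by norm_num) f

theorem mulConst_apply (A : F →L[ℂ] F) (f : Hardy F) (n : ℕ) : mulConst A f n = A (f n) := rfl

theorem shift_zero (f : Hardy F) : shift f 0 = 0 := rfl

theorem shift_succ (f : Hardy F) (n : ℕ) : shift f (n + 1) = f n := rfl

theorem add_apply (f g : Hardy F) (n : ℕ) : (f + g) n = f n + g n := rfl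

theorem smul_apply (c : ℂ) (f : Hardy F) (n : ℕ) : (c • f) n = c • f n := rfl

theorem rotation_apply (q : Circle) (f : Hardy F) (n : ℕ) :
    rotation q f n = (q : ℂ) ^ n • f n := rfl

theorem mulPencil_zero (A B : F →L[ℂ] F) (f : Hardy F) : mulPencil A B f 0 = A (f 0) :=
  add_zero _

theorem mulPencil_succ (A B : F →L[ℂ] F) (f : Hardy F) (n : ℕ) :
    mulPencil A B f (n + 1) = A (f (n + 1)) + B (f n) := rfl

theorem norm_shift (f : Hardy F) : ‖shift f‖ = ‖f‖ := by
  have h := (hasSum_nat_add_iff' 1).mpr (hasSum_norm_sq (shift f))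
  simp only [shift_succ, Finset.range_one, Finset.sum_singleton, shift_zero, norm_zero] at h
  have := h.unique (hasSum_norm_sq f)
  rw [← sq_eq_sq₀ (norm_nonneg _) (norm_nonneg _)]
  simpa using this

theorem norm_rotation (q : Circle) (f : Hardy F) : ‖rotation q f‖ = ‖f‖ := by
  rw [← sq_eq_sq₀ (norm_nonneg _) (norm_nonneg _)]
  refine (hasSum_norm_sq _).unique ?_
  simpa [rotation_apply, norm_smul, Circle.norm_coe] using hasSum_norm_sq f

/-- In each coefficient the contributions of `A` and `zB` lie in orthogonal ranges, so Pythagoras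
applies to the two whole functions, and the shift does not change the norm of the second. -/
theorem norm_mulPencil {A B : F →L[ℂ] F} (horth : ∀ x y, inner ℂ (A x) (B y) = 0)
    (hnorm : ∀ x, ‖A x‖ ^ 2 + ‖B x‖ ^ 2 = ‖x‖ ^ 2) (f : Hardy F) : ‖mulPencil A B f‖ = ‖f‖ := by
  have h0 : inner ℂ (mulConst A f) (shift (mulConst B f)) = 0 := by
    rw [lp.inner_eq_tsum]
    refine (tsum_congr fun n => ?_).trans tsum_zero
    cases n with
    | zero => rw [shift_zero, inner_zero_right]
    | succ n => exact horth _ _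
  have h1 := norm_add_sq_eq_norm_sq_add_norm_sq_of_inner_eq_zero _ _ h0
  have h2 : ‖mulConst A f‖ ^ 2 + ‖mulConst B f‖ ^ 2 = ‖f‖ ^ 2 := by
    refine ((hasSum_norm_sq _).add (hasSum_norm_sq _)).unique ?_
    simpa [mulConst_apply, hnorm] using hasSum_norm_sq f
  rw [norm_shift, ← sq, ← sq, ← sq, h2] at h1
  exact (sq_eq_sq₀ (norm_nonneg _) (norm_nonneg _)).mp h1

theorem ev0_apply (f : Hardy F) : ev0 f = f 0 := rfl

theorem adjoint_ev0_apply [CompleteSpace F] (a : F) : adjoint ev0 a = lp.single 2 0 a := by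
  refine ext_inner_right ℂ fun f => ?_
  rw [adjoint_inner_left, lp.inner_single_left, ev0_apply]

theorem adjoint_ev0_apply_zero [CompleteSpace F] (a : F) : (adjoint ev0 a : Hardy F) 0 = a := by
  rw [adjoint_ev0_apply, lp.single_apply_self]

theorem adjoint_ev0_apply_succ [CompleteSpace F] (a : F) (n : ℕ) :
    (adjoint ev0 a : Hardy F) (n + 1) = 0 := by
  rw [adjoint_ev0_apply, lp.single_apply_ne _ _ _ n.succ_ne_zero]

theorem mulPencil_single (A B : F →L[ℂ] F) (n : ℕ) (a : F) :
    mulPencil A B (lp.single 2 n a) = lp.single 2 n (A a) + lp.single 2 (n + 1) (B a) := by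
  have hA : ∀ m, A (lp.single (E := fun _ : ℕ => F) 2 n a m) =
      lp.single (E := fun _ : ℕ => F) 2 n (A a) m := fun m => by
    simp only [lp.single_apply]
    exact Pi.apply_single (fun _ => A) (fun _ => map_zero A) n a m
  have hB : ∀ m, B (lp.single (E := fun _ : ℕ => F) 2 n a m) =
      lp.single (E := fun _ : ℕ => F) 2 n (B a) m := fun m => by
    simp only [lp.single_apply]
    exact Pi.apply_single (fun _ => B) (fun _ => map_zero B) n a m
  ext m
  cases m with
  | zero =>
    rw [mulPencil_zero, hA, lp.coeFn_add, Pi.add_apply,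
      lp.single_apply_ne _ _ _ n.succ_ne_zero.symm, add_zero]
  | succ m =>
    rw [mulPencil_succ, hA, hB, lp.coeFn_add, Pi.add_apply]
    simp [lp.single_apply, Pi.single_apply]

theorem rotation_single (q : Circle) (n : ℕ) (a : F) :
    rotation q (lp.single 2 n a) = (q : ℂ) ^ n • lp.single 2 n a := by
  ext m
  rw [rotation_apply, lp.coeFn_smul, Pi.smul_apply]
  obtain rfl | h := eq_or_ne m n
  · rfl
  · rw [lp.single_apply_ne _ _ _ h, smul_zero, smul_zero]

end Hardy

end Hardy

/-! ### Block operators and the projections of an Andô tuple -/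

section Model

variable {H : Type u} [NormedAddCommGroup H] [InnerProductSpace ℂ H] [CompleteSpace H]
variable {G : Type v} [NormedAddCommGroup G] [InnerProductSpace ℂ G] [CompleteSpace G]
variable {F : Type v} [NormedAddCommGroup F] [InnerProductSpace ℂ F] [CompleteSpace F]

theorem lowerBlock_apply (X : H →L[ℂ] H) (Y : H →L[ℂ] G) (Z : G →L[ℂ] G) (x : WithLp 2 (H × G)) :
    lowerBlock X Y Z x = WithLp.toLp 2 (X x.fst, Y x.fst + Z x.snd) := rfl

theorem inclusion_apply (h : H) : inclusion H G h = WithLp.toLp 2 (h, 0) := rfl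

theorem adjoint_lowerBlock_inclusion (X : H →L[ℂ] H) (Y : H →L[ℂ] G) (Z : G →L[ℂ] G) (h : H) :
    adjoint (lowerBlock X Y Z) (inclusion H G h) = inclusion H G (adjoint X h) := by
  refine ext_inner_right ℂ fun x => ?_
  rw [adjoint_inner_left]
  simp [inclusion_apply, lowerBlock_apply, WithLp.prod_inner_apply, adjoint_inner_left]

/-- The hypotheses are the entries of `V* V = 1`: the two columns are isometric and mutually
orthogonal. -/
theorem isometry_lowerBlock {X : H →L[ℂ] H} {Y : H →L[ℂ] G} {Z : G →L[ℂ] G}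
    (hXY : ∀ h, ‖X h‖ ^ 2 + ‖Y h‖ ^ 2 = ‖h‖ ^ 2) (hZ : ∀ g, ‖Z g‖ = ‖g‖)
    (hYZ : ∀ h g, inner ℂ (Y h) (Z g) = 0) : Isometry (lowerBlock X Y Z) := by
  refine AddMonoidHomClass.isometry_of_norm _ fun x => ?_
  rw [← sq_eq_sq₀ (norm_nonneg _) (norm_nonneg _), WithLp.prod_norm_sq_eq_of_L2,
    WithLp.prod_norm_sq_eq_of_L2, lowerBlock_apply]
  have h1 := norm_add_sq_eq_norm_sq_add_norm_sq_of_inner_eq_zero _ _ (hYZ x.fst x.snd)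
  have h2 := hXY x.fst
  simp only [WithLp.toLp_fst, WithLp.toLp_snd]
  rw [sq ‖Y _ + _‖, h1, hZ]
  linarith

namespace AndoTuple

variable {T₁ T₂ : H →L[ℂ] H} (A : AndoTuple T₁ T₂ F)

theorem Uop_apply (x : F) : A.Uop x = A.U x := rfl

theorem adjoint_Uop_apply (x : F) : adjoint A.Uop x = A.U.symm x := by
  refine ext_inner_right ℂ fun y => ?_
  rw [adjoint_inner_left, Uop_apply, ← A.U.inner_map_map (A.U.symm x), A.U.apply_symm_apply]

theorem adjoint_Uop : adjoint A.Uop = A.U.symm.toLinearIsometry.toContinuousLinearMap :=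
  ContinuousLinearMap.ext A.adjoint_Uop_apply

theorem Pperp_apply (x : F) : A.Pperp x = x - A.P x := rfl

theorem P_P (x : F) : A.P (A.P x) = A.P x :=
  congr($(A.isStarProjection_P.isIdempotentElem) x)

theorem P_Pperp (x : F) : A.P (A.Pperp x) = 0 := by
  rw [Pperp_apply, map_sub, P_P, sub_self]

theorem Pperp_P (x : F) : A.Pperp (A.P x) = 0 := by
  rw [Pperp_apply, P_P, sub_self]

theorem Pperp_Pperp (x : F) : A.Pperp (A.Pperp x) = A.Pperp x := by
  rw [Pperp_apply A (A.Pperp x), P_Pperp, sub_zero]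

theorem inner_P (x y : F) : inner ℂ (A.P x) y = inner ℂ x (A.P y) := by
  conv_rhs => rw [← adjoint_inner_left]
  rw [show adjoint A.P = A.P from A.isStarProjection_P.isSelfAdjoint]

theorem inner_P_Pperp (x y : F) : inner ℂ (A.P x) (A.Pperp y) = 0 := by
  rw [inner_P, P_Pperp, inner_zero_right]

theorem inner_Pperp_P (x y : F) : inner ℂ (A.Pperp x) (A.P y) = 0 := by
  rw [← inner_conj_symm, inner_P_Pperp, map_zero]

theorem P_add_Pperp (x : F) : A.P x + A.Pperp x = x := by
  rw [Pperp_apply]; abel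

theorem norm_P_sq_add (x : F) : ‖A.P x‖ ^ 2 + ‖A.Pperp x‖ ^ 2 = ‖x‖ ^ 2 := by
  have := norm_add_sq_eq_norm_sq_add_norm_sq_of_inner_eq_zero _ _ (A.inner_P_Pperp x x)
  rw [P_add_Pperp] at this
  linarith

/-- Self-adjointness of `D_T`. It turns the first two relations of (R) into the form `X* X + Y* Y =
1`. -/
theorem DΛadj_eq : A.DΛadj = adjoint A.ΛD := by
  have h2 : adjoint (defectOp (T₁ * T₂)) = defectOp (T₁ * T₂) :=
    (CFC.sqrt_nonneg _).isSelfAdjoint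
  ext x
  refine ext_inner_right ℂ fun y => ?_
  rw [adjoint_inner_left]
  change inner ℂ (defectOp (T₁ * T₂) (adjoint A.Λ.toContinuousLinearMap x : H)) y =
    inner ℂ x (A.Λ.toContinuousLinearMap (defectMap (T₁ * T₂) y))
  rw [← adjoint_inner_left, ← adjoint_inner_right, h2]
  rfl

end AndoTuple

end Model

/-! ### The relations (R) and the model pair -/

section Model

variable {H : Type u} [NormedAddCommGroup H] [InnerProductSpace ℂ H] [CompleteSpace H]
variable {F : Type v} [NormedAddCommGroup F] [InnerProductSpace ℂ F] [CompleteSpace F]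

/-- Over `ℂ` an operator is determined by its quadratic form. -/
theorem adjoint_comp_self_add_eq_one {X : H →L[ℂ] H} {Y : H →L[ℂ] F}
    (h : ∀ x, ‖X x‖ ^ 2 + ‖Y x‖ ^ 2 = ‖x‖ ^ 2) : adjoint X ∘L X + adjoint Y ∘L Y = 1 := by
  refine ContinuousLinearMap.coe_injective ((ext_inner_map _ _).mp fun x => ?_)
  change inner ℂ (adjoint X (X x) + adjoint Y (Y x)) x = inner ℂ x x
  rw [inner_add_left, adjoint_inner_left, adjoint_inner_left]
  simp only [inner_self_eq_norm_sq_to_K]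
  exact_mod_cast h x

theorem circle_mul_conj (q : Circle) : (q : ℂ) * conj (q : ℂ) = 1 := by
  rw [← Circle.coe_inv_eq_conj, ← Circle.coe_mul, mul_inv_cancel, Circle.coe_one]

theorem conj_mul_circle (q : Circle) : conj (q : ℂ) * (q : ℂ) = 1 := by
  rw [mul_comm, circle_mul_conj]

namespace AndoTuple

variable {T₁ T₂ : H →L[ℂ] H} (A : AndoTuple T₁ T₂ F)

/-- The relations (R), expressed on vectors. -/
structure VectorRelations : Prop where
  norm₁ : ∀ h, ‖T₁ h‖ ^ 2 + ‖A.P (A.U (A.ΛD h))‖ ^ 2 = ‖h‖ ^ 2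
  norm₂ : ∀ h, ‖T₂ h‖ ^ 2 + ‖A.Pperp (A.ΛD h)‖ ^ 2 = ‖h‖ ^ 2
  decomp : ∀ h, A.P (A.U (A.ΛD (T₂ h))) + A.Pperp (A.ΛD h) = A.ΛD h
  U_decomp : ∀ h, A.U (A.ΛD h) = A.Pperp (A.ΛD (T₁ h)) + A.P (A.U (A.ΛD h))

variable {A}

theorem VectorRelations.relations (hA : A.VectorRelations) : A.Relations where
  rel₁ := by
    rw [← adjoint_comp_self_add_eq_one (Y := A.P ∘L A.Uop ∘L A.ΛD) hA.norm₁, DΛadj_eq,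
      adjoint_comp, adjoint_comp, show adjoint A.P = A.P from A.isStarProjection_P.isSelfAdjoint]
    ext h
    simp [P_P]
  rel₂ := by
    have hP : adjoint A.Pperp = A.Pperp := A.isStarProjection_P.one_sub.isSelfAdjoint
    rw [← adjoint_comp_self_add_eq_one (Y := A.Pperp ∘L A.ΛD) hA.norm₂, DΛadj_eq,
      adjoint_comp, hP]
    ext h
    simp [Pperp_Pperp]
  rel₃ := by ext h; exact hA.decomp h
  rel₄ := by
    ext h
    change _ = adjoint A.Uop (A.Pperp (A.ΛD (T₁ h)) + A.P (A.U (A.ΛD h)))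
    rw [← hA.U_decomp, adjoint_Uop_apply, A.U.symm_apply_apply]

theorem norm_Uop (x : F) : ‖A.Uop x‖ = ‖x‖ := A.U.norm_map x

theorem norm_adjoint_Uop (x : F) : ‖adjoint A.Uop x‖ = ‖x‖ := by
  rw [adjoint_Uop_apply, A.U.symm.norm_map]

theorem inner_adjoint_Uop (x y : F) :
    inner ℂ (adjoint A.Uop x) (adjoint A.Uop y) = inner ℂ x y := by
  rw [adjoint_Uop_apply, adjoint_Uop_apply, A.U.symm.inner_map_map]

theorem isometry_schaffer₁ (q : Circle) (hA : A.VectorRelations) : Isometry (schaffer₁ q A) := by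
  refine isometry_lowerBlock (fun h => ?_) (fun g => ?_) fun h g => ?_
  · rw [← hA.norm₁ h]
    change _ + ‖adjoint Hardy.ev0 (A.P (A.U (A.ΛD h)))‖ ^ 2 = _
    rw [Hardy.adjoint_ev0_apply, lp.norm_single (by norm_num)]
  · change ‖(q : ℂ) • Hardy.mulPencil _ _ (Hardy.rotation q g)‖ = _
    rw [norm_smul, Circle.norm_coe, one_mul, Hardy.norm_mulPencil, Hardy.norm_rotation]
    · exact fun x y => A.inner_Pperp_P _ _
    · intro x
      rw [add_comm, ← A.norm_Uop x]
      exact A.norm_P_sq_add _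
  -- Only constant coefficients meet here: one lies in the range of `P`, the other in that of `P^⊥`.
  · change inner ℂ (adjoint Hardy.ev0 (A.P (A.U (A.ΛD h))))
      ((q : ℂ) • Hardy.mulPencil _ _ (Hardy.rotation q g)) = 0
    rw [Hardy.adjoint_ev0_apply, inner_smul_right, lp.inner_single_left, Hardy.mulPencil_zero]
    exact mul_eq_zero_of_right _ (A.inner_P_Pperp _ _)

theorem isometry_schaffer₂ (q : Circle) (hA : A.VectorRelations) : Isometry (schaffer₂ q A) := by
  have hq : ‖conj (q : ℂ)‖ = 1 := by rw [RCLike.norm_conj, Circle.norm_coe]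
  refine isometry_lowerBlock (fun h => ?_) (fun g => ?_) fun h g => ?_
  · rw [← hA.norm₂ h]
    change _ + ‖conj (q : ℂ) • adjoint Hardy.ev0 (adjoint A.Uop (A.Pperp (A.ΛD h)))‖ ^ 2 = _
    rw [norm_smul, hq, one_mul, Hardy.adjoint_ev0_apply, lp.norm_single (by norm_num),
      norm_adjoint_Uop]
  · change ‖conj (q : ℂ) • Hardy.rotation q⁻¹ (Hardy.mulPencil _ _ g)‖ = _
    rw [norm_smul, hq, one_mul, Hardy.norm_rotation, Hardy.norm_mulPencil]
    · intro x y
      simp only [coe_comp, Function.comp_apply, inner_adjoint_Uop]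
      exact A.inner_P_Pperp _ _
    · intro x
      simp only [coe_comp, Function.comp_apply, norm_adjoint_Uop]
      exact A.norm_P_sq_add _
  · change inner ℂ (conj (q : ℂ) • adjoint Hardy.ev0 (adjoint A.Uop (A.Pperp (A.ΛD h))))
      (conj (q : ℂ) • Hardy.rotation q⁻¹ (Hardy.mulPencil _ _ g)) = 0
    rw [Hardy.adjoint_ev0_apply, inner_smul_right, inner_smul_left, lp.inner_single_left,
      Hardy.rotation_apply, Hardy.mulPencil_zero, pow_zero, one_smul]
    refine mul_eq_zero_of_right _ (mul_eq_zero_of_right _ ?_)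
    simp only [coe_comp, Function.comp_apply, inner_adjoint_Uop]
    exact A.inner_Pperp_P _ _

theorem schaffer₁_apply (q : Circle) (x : WithLp 2 (H × Hardy F)) :
    schaffer₁ q A x = WithLp.toLp 2 (T₁ x.fst, adjoint Hardy.ev0 (A.P (A.U (A.ΛD x.fst))) +
      (q : ℂ) • Hardy.mulPencil (A.Pperp ∘L A.Uop) (A.P ∘L A.Uop)
        (Hardy.rotation q x.snd)) := rfl

theorem schaffer₂_apply (q : Circle) (x : WithLp 2 (H × Hardy F)) :
    schaffer₂ q A x = WithLp.toLp 2 (T₂ x.fst,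
      conj (q : ℂ) • adjoint Hardy.ev0 (adjoint A.Uop (A.Pperp (A.ΛD x.fst))) +
      conj (q : ℂ) • Hardy.rotation q⁻¹
        (Hardy.mulPencil (adjoint A.Uop ∘L A.P) (adjoint A.Uop ∘L A.Pperp) x.snd)) := rfl

/-- The rotations cancel and the symbols `(P^⊥ + zP)U` and `U*(P + zP^⊥)` multiply to `z`. The only
relation needed is `decomp`, in the constant coefficient. -/
theorem schaffer₁_schaffer₂ (q : Circle) (hA : A.VectorRelations) (x : WithLp 2 (H × Hardy F)) :
    schaffer₁ q A (schaffer₂ q A x) =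
      WithLp.toLp 2 (T₁ (T₂ x.fst), adjoint Hardy.ev0 (A.ΛD x.fst) + Hardy.shift x.snd) := by
  have hq : ∀ n : ℕ, (q : ℂ) ^ n * (conj (q : ℂ)) ^ n = 1 := fun n => by
    rw [← mul_pow, circle_mul_conj, one_pow]
  rw [schaffer₂_apply, schaffer₁_apply]
  simp only [WithLp.toLp_fst, WithLp.toLp_snd]
  congr 2
  ext n
  -- Coefficient 1 is separate: the factor `z` carries the `ev₀*` term there, where `P P^⊥ = 0`
  -- kills it. Later coefficients do not see that term.
  obtain _ | _ | n := n <;>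
    simp only [Hardy.add_apply, Hardy.mulPencil_zero, Hardy.mulPencil_succ,
    Hardy.adjoint_ev0_apply_zero, Hardy.adjoint_ev0_apply_succ, Hardy.rotation_apply,
    Hardy.shift_zero, Hardy.shift_succ, Uop_apply, adjoint_Uop_apply, P_P, P_Pperp, Pperp_P,
    Pperp_Pperp, coe_comp, Function.comp_apply, map_add, map_smul, map_zero, smul_zero, add_zero,
    zero_add, pow_zero, one_smul, Circle.coe_inv_eq_conj, A.U.apply_symm_apply, smul_add, smul_smul, circle_mul_conj]
  · rw [hA.decomp]
  · rw [hq, one_smul, add_comm, P_add_Pperp]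
  · rw [hq, hq, one_smul, one_smul, add_comm, P_add_Pperp]

/-- The other order gives the same Hardy component, now with `U_decomp` in the constant coefficient.
So the model `q`-commutes as soon as `T₁ T₂ = q T₂ T₁`. -/
theorem smul_schaffer₂_schaffer₁ (q : Circle) (hA : A.VectorRelations)
    (x : WithLp 2 (H × Hardy F)) :
    (q : ℂ) • schaffer₂ q A (schaffer₁ q A x) =
      WithLp.toLp 2 ((q : ℂ) • T₂ (T₁ x.fst),
        adjoint Hardy.ev0 (A.ΛD x.fst) + Hardy.shift x.snd) := by
  rw [schaffer₁_apply, schaffer₂_apply, ← WithLp.toLp_smul, Prod.smul_mk]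
  simp only [WithLp.toLp_fst, WithLp.toLp_snd]
  have h := congr(A.U.symm $(hA.U_decomp x.fst))
  rw [A.U.symm_apply_apply, map_add] at h
  congr 2
  ext n
  obtain _ | _ | n := n <;>
    simp only [Hardy.add_apply, Hardy.smul_apply, Hardy.mulPencil_zero, Hardy.mulPencil_succ,
    Hardy.adjoint_ev0_apply_zero, Hardy.adjoint_ev0_apply_succ, Hardy.rotation_apply,
    Hardy.shift_zero, Hardy.shift_succ, Uop_apply, adjoint_Uop_apply, P_P, P_Pperp, Pperp_P,
    Pperp_Pperp, coe_comp, Function.comp_apply, map_add, map_smul, map_zero, smul_zero, add_zero,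
    zero_add, pow_zero, one_smul, Circle.coe_inv_eq_conj, smul_add, smul_smul, circle_mul_conj]
  · exact h.symm
  · rw [conj_mul_circle, mul_one, pow_one, circle_mul_conj, one_smul, one_smul, ← map_add,
      P_add_Pperp, A.U.symm_apply_apply]
  · have hq : (q : ℂ) * (conj (q : ℂ) * q) * (conj (q : ℂ) ^ (n + 1 + 1) * (q : ℂ) ^ (n + 1)) =
        1 := by
      calc _ = (q * conj (q : ℂ)) ^ (n + 3) := by ring
        _ = 1 := by rw [circle_mul_conj, one_pow]
    rw [hq, one_smul, one_smul, ← map_add, P_add_Pperp, A.U.symm_apply_apply]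

theorem VectorRelations.isIsometricLift {q : Circle} (hT : IsQCommuting q T₁ T₂)
    (hA : A.VectorRelations) :
    IsIsometricLift q T₁ T₂ (inclusion H (Hardy F)) (schaffer₁ q A) (schaffer₂ q A) where
  isometry₁ := isometry_schaffer₁ q hA
  isometry₂ := isometry_schaffer₂ q hA
  q_commuting := by
    ext1 x
    change schaffer₁ q A (schaffer₂ q A x) = (q : ℂ) • schaffer₂ q A (schaffer₁ q A x)
    rw [schaffer₁_schaffer₂ q hA, smul_schaffer₂_schaffer₁ q hA,
      show T₁ (T₂ x.fst) = (q : ℂ) • T₂ (T₁ x.fst) from congr($hT x.fst)]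
  lift₁ := adjoint_lowerBlock_inclusion _ _ _
  lift₂ := adjoint_lowerBlock_inclusion _ _ _

/-- `P U Λ D_T h` is `D_{T₁} h` in the first slot and `P^⊥ Λ D_T h` is `D_{T₂} h` in the second. The
norm identities are then the defect formula, and the decompositions split a vector into its slots.
-/
theorem IsSpecial.vectorRelations {E : Type w} [NormedAddCommGroup E]
    [InnerProductSpace ℂ E] [CompleteSpace E] {A : AndoTuple T₁ T₂ (AndoSpace T₁ T₂ E)}
    (hT₁ : ‖T₁‖ ≤ 1) (hT₂ : ‖T₂‖ ≤ 1) (hA : A.IsSpecial) : A.VectorRelations := by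
  have hΛ : ∀ h, A.ΛD h = AndoSpace.mk (defectMap T₁ (T₂ h)) (defectMap T₂ h) 0 := hA.Λ_apply
  have hU : ∀ h, A.U (A.ΛD h) = AndoSpace.mk (defectMap T₁ h) (defectMap T₂ (T₁ h)) 0 :=
    fun h => by rw [hΛ, hA.U_apply]
  have hperp : ∀ x y e, A.Pperp (AndoSpace.mk x y e) = AndoSpace.mk 0 y e := fun x y e => by
    rw [Pperp_apply, hA.P_apply]
    simp [AndoSpace.mk, ← WithLp.toLp_sub]
  have hnorm : ∀ x y, ‖(AndoSpace.mk x y 0 : AndoSpace T₁ T₂ E)‖ ^ 2 = ‖x‖ ^ 2 + ‖y‖ ^ 2 :=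
    fun x y => by simp [AndoSpace.mk, WithLp.prod_norm_sq_eq_of_L2]
  have hadd : ∀ x y, (AndoSpace.mk x 0 0 + AndoSpace.mk 0 y 0 : AndoSpace T₁ T₂ E) =
      AndoSpace.mk x y 0 := fun x y => by simp [AndoSpace.mk, ← WithLp.toLp_add]
  refine ⟨fun h => ?_, fun h => ?_, fun h => ?_, fun h => ?_⟩
  · rw [hU, hA.P_apply, hnorm, norm_defectMap, norm_defectOp_sq hT₁, norm_zero]
    ring
  · rw [hΛ, hperp, hnorm, norm_defectMap, norm_defectOp_sq hT₂, norm_zero]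
    ring
  · rw [hU, hA.P_apply, hΛ, hperp, hadd]
  · rw [hU, hA.P_apply, hΛ, hperp, add_comm, hadd]

end AndoTuple

end Model

/-! ### Wold decomposition of a pure isometry -/

section Wold

variable {G : Type v} [NormedAddCommGroup G] [InnerProductSpace ℂ G] [CompleteSpace G]

theorem adjoint_apply_of_isometry {W : G →L[ℂ] G} (hW : Isometry W) (x : G) :
    adjoint W (W x) = x :=
  congr($((isometry_iff_adjoint_comp_self W).mp hW) x)

theorem norm_apply_of_isometry {W : G →L[ℂ] G} (hW : Isometry W) (x : G) : ‖W x‖ = ‖x‖ :=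
  (AddMonoidHomClass.isometry_iff_norm W).mp hW x

theorem inner_apply_of_isometry {W : G →L[ℂ] G} (hW : Isometry W) (x y : G) :
    inner ℂ (W x) (W y) = inner ℂ x y := by
  rw [← adjoint_inner_left, adjoint_apply_of_isometry hW]

theorem isometry_pow {W : G →L[ℂ] G} (hW : Isometry W) (n : ℕ) : Isometry (W ^ n) := by
  induction n with
  | zero => exact isometry_id
  | succ n ih => rw [pow_succ]; exact ih.comp hW

/-- The wandering subspace of an isometry `W`, the orthogonal complement of its range. -/
abbrev wandering (W : G →L[ℂ] G) : Submodule ℂ G := (adjoint W).ker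

/-- The operator `W` is pure: the ranges of its powers intersect trivially. -/
def IsPure (W : G →L[ℂ] G) : Prop := ∀ x, (∀ n : ℕ, ∃ y, (W ^ n) y = x) → x = 0

/-- The isometric embedding `a ↦ Wⁿ a` of the wandering subspace. -/
def wanderingPow {W : G →L[ℂ] G} (hW : Isometry W) (n : ℕ) : wandering W →ₗᵢ[ℂ] G where
  toLinearMap := ((W ^ n) ∘L (wandering W).subtypeL : wandering W →L[ℂ] G)
  norm_map' a := norm_apply_of_isometry (isometry_pow hW n) (a : G)

theorem wanderingPow_apply {W : G →L[ℂ] G} (hW : Isometry W) (n : ℕ) (a : wandering W) :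
    wanderingPow hW n a = (W ^ n) (a : G) := rfl

theorem inner_wandering {W : G →L[ℂ] G} {a : G} (ha : adjoint W a = 0) (x : G) :
    inner ℂ a (W x) = 0 := by
  rw [← adjoint_inner_left, ha, inner_zero_left]

theorem orthogonalFamily_wanderingPow {W : G →L[ℂ] G} (hW : Isometry W) :
    OrthogonalFamily ℂ (fun _ : ℕ => wandering W) (wanderingPow hW) := by
  have key : ∀ (n k : ℕ) (a b : wandering W),
      inner ℂ (wanderingPow hW n a) (wanderingPow hW (n + k + 1) b) = 0 := fun n k a b => by
    rw [wanderingPow_apply, wanderingPow_apply, add_assoc, pow_add]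
    change inner ℂ ((W ^ n) (a : G)) ((W ^ n) ((W ^ (k + 1)) (b : G))) = 0
    rw [inner_apply_of_isometry (isometry_pow hW n), pow_succ']
    exact inner_wandering a.2 _
  intro m n hmn a b
  obtain h | h := lt_or_gt_of_ne hmn
  · obtain ⟨k, rfl⟩ := Nat.exists_eq_add_of_lt h
    exact key m k a b
  · obtain ⟨k, rfl⟩ := Nat.exists_eq_add_of_lt h
    rw [← inner_conj_symm, key n k b a, map_zero]

theorem sub_apply_adjoint_mem_wandering {W : G →L[ℂ] G} (hW : Isometry W) (y : G) :
    adjoint W (y - W (adjoint W y)) = 0 := by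
  rw [map_sub, adjoint_apply_of_isometry hW, sub_self]

/-- The vector `y - W W* y` is wandering, hence orthogonal to `y` and to the range of `W`, hence to
itself. -/
theorem mem_range_of_orthogonal_wandering {W : G →L[ℂ] G} (hW : Isometry W) {y : G}
    (hy : ∀ a, adjoint W a = 0 → inner ℂ a y = 0) : W (adjoint W y) = y := by
  have h1 := sub_apply_adjoint_mem_wandering hW y
  have h2 := hy _ h1
  have h3 := inner_wandering h1 (adjoint W y)
  have h4 : inner ℂ (y - W (adjoint W y)) (y - W (adjoint W y)) = 0 := by
    conv_lhs => rw [inner_sub_right, h2, h3, sub_zero]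
  exact (sub_eq_zero.mp (inner_self_eq_zero.mp h4)).symm

/-- A vector orthogonal to every `Wⁿ ker W*` lies, by induction, in the range of every `Wⁿ`; purity
makes it zero. -/
theorem isHilbertSum_wanderingPow {W : G →L[ℂ] G} (hW : Isometry W) (hpure : IsPure W) :
    IsHilbertSum ℂ (fun _ : ℕ => wandering W) (wanderingPow hW) := by
  refine IsHilbertSum.mk (orthogonalFamily_wanderingPow hW) (top_le_iff.mpr ?_)
  rw [Submodule.topologicalClosure_eq_top_iff, Submodule.eq_bot_iff]
  intro x hx
  have hx' : ∀ n (a : wandering W), inner ℂ ((W ^ n) (a : G)) x = 0 := fun n a =>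
    (Submodule.mem_orthogonal _ _).mp hx _ (Submodule.mem_iSup_of_mem n ⟨a, rfl⟩)
  refine hpure x fun n => ?_
  induction n with
  | zero => exact ⟨x, rfl⟩
  | succ n ih =>
    obtain ⟨y, rfl⟩ := ih
    refine ⟨adjoint W y, ?_⟩
    rw [pow_succ]
    change (W ^ n) (W (adjoint W y)) = _
    rw [mem_range_of_orthogonal_wandering hW fun a ha => ?_]
    rw [← inner_apply_of_isometry (isometry_pow hW n)]
    exact hx' n ⟨a, ha⟩

/-- The Wold decomposition of a pure isometry: `W` is unitarily equivalent to the shift on the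
Hardy space over the wandering subspace. -/
def woldEquiv {W : G →L[ℂ] G} (hW : Isometry W) (hpure : IsPure W) : G ≃ₗᵢ[ℂ] Hardy (wandering W) :=
  (isHilbertSum_wanderingPow hW hpure).linearIsometryEquiv

theorem woldEquiv_symm_single {W : G →L[ℂ] G} (hW : Isometry W) (hpure : IsPure W) (n : ℕ)
    (a : wandering W) : (woldEquiv hW hpure).symm (lp.single 2 n a) = (W ^ n) (a : G) :=
  (isHilbertSum_wanderingPow hW hpure).linearIsometryEquiv_symm_apply_single a

theorem Hardy.ext_single {F : Type*} [NormedAddCommGroup F] [InnerProductSpace ℂ F]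
    {S R : Hardy F →L[ℂ] G} (h : ∀ n a, S (lp.single 2 n a) = R (lp.single 2 n a)) : S = R :=
  lp.ext_continuousLinearMap (by norm_num) fun n => ContinuousLinearMap.ext (h n)

/-- Moving `V` past `Wⁿ` costs `qⁿ`, which is what `R_q` does to `zⁿ a`. So `V` is determined by its
values on the wandering subspace, and monomials suffice for the check. -/
theorem woldEquiv_symm_mulPencil_rotation {W : G →L[ℂ] G} (hW : Isometry W) (hpure : IsPure W)
    {q : Circle} {V : G →L[ℂ] G} (hVW : ∀ x, V (W x) = (q : ℂ) • W (V x))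
    {X Y : wandering W →L[ℂ] wandering W}
    (hV : ∀ a : wandering W, V a = (q : ℂ) • ((X a : G) + W (Y a))) (f : Hardy (wandering W)) :
    (woldEquiv hW hpure).symm ((q : ℂ) • Hardy.mulPencil X Y (Hardy.rotation q f)) =
      V ((woldEquiv hW hpure).symm f) := by
  let Φ : Hardy (wandering W) →L[ℂ] G :=
    (woldEquiv hW hpure).symm.toLinearIsometry.toContinuousLinearMap
  have hΦs : ∀ n a, Φ (lp.single 2 n a) = (W ^ n) (a : G) := woldEquiv_symm_single hW hpure
  have hVn : ∀ (n : ℕ) x, V ((W ^ n) x) = (q : ℂ) ^ n • (W ^ n) (V x) := fun n => by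
    induction n with
    | zero => simp
    | succ n ih =>
      intro x
      rw [pow_succ' W]
      change V (W ((W ^ n) x)) = (q : ℂ) ^ (n + 1) • W ((W ^ n) (V x))
      rw [hVW, ih, map_smul, smul_smul, pow_succ']
  suffices h : Φ ∘L ((q : ℂ) • (Hardy.mulPencil X Y ∘L Hardy.rotation q)) = V ∘L Φ from congr($h f)
  refine Hardy.ext_single fun n a => ?_
  change Φ ((q : ℂ) • Hardy.mulPencil X Y (Hardy.rotation q (lp.single 2 n a))) =
    V (Φ (lp.single 2 n a))
  have hWs : ∀ x, (W ^ (n + 1)) x = (W ^ n) (W x) := fun x => by rw [pow_succ]; rfl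
  simp only [Hardy.rotation_single, map_smul, Hardy.mulPencil_single, map_add, hΦs, hVn, hV, hWs]
  rw [smul_comm]

/-- Here the rotation acts after the multiplier, so the term of degree `n + 1` picks up one more
`q̄`; this is the inner `q̄` in `hV`. -/
theorem woldEquiv_symm_rotation_mulPencil {W : G →L[ℂ] G} (hW : Isometry W) (hpure : IsPure W)
    {q : Circle} {V : G →L[ℂ] G} (hVW : ∀ x, V (W x) = conj (q : ℂ) • W (V x))
    {X Y : wandering W →L[ℂ] wandering W}
    (hV : ∀ a : wandering W, V a = conj (q : ℂ) • ((X a : G) + conj (q : ℂ) • W (Y a)))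
    (f : Hardy (wandering W)) :
    (woldEquiv hW hpure).symm (conj (q : ℂ) • Hardy.rotation q⁻¹ (Hardy.mulPencil X Y f)) =
      V ((woldEquiv hW hpure).symm f) := by
  let Φ : Hardy (wandering W) →L[ℂ] G :=
    (woldEquiv hW hpure).symm.toLinearIsometry.toContinuousLinearMap
  have hΦs : ∀ n a, Φ (lp.single 2 n a) = (W ^ n) (a : G) := woldEquiv_symm_single hW hpure
  have hVn : ∀ (n : ℕ) x, V ((W ^ n) x) = conj (q : ℂ) ^ n • (W ^ n) (V x) := fun n => by
    induction n with
    | zero => simp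
    | succ n ih =>
      intro x
      rw [pow_succ' W]
      change V (W ((W ^ n) x)) = conj (q : ℂ) ^ (n + 1) • W ((W ^ n) (V x))
      rw [hVW, ih, map_smul, smul_smul, pow_succ']
  suffices h : Φ ∘L (conj (q : ℂ) • (Hardy.rotation q⁻¹ ∘L Hardy.mulPencil X Y)) = V ∘L Φ from
    congr($h f)
  refine Hardy.ext_single fun n a => ?_
  change Φ (conj (q : ℂ) • Hardy.rotation q⁻¹ (Hardy.mulPencil X Y (lp.single 2 n a))) =
    V (Φ (lp.single 2 n a))
  have hWs : ∀ x, (W ^ (n + 1)) x = (W ^ n) (W x) := fun x => by rw [pow_succ]; rfl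
  simp only [Hardy.rotation_single, map_smul, Hardy.mulPencil_single, map_add, hΦs, hVn, hV, hWs,
    Circle.coe_inv_eq_conj, smul_add, smul_smul, pow_succ (conj (q : ℂ))]
  ring_nf

end Wold

/-! ### Berger–Coburn–Lebow structure of `q`-commuting isometries -/

section BergerCoburnLebow

variable {G : Type v} [NormedAddCommGroup G] [InnerProductSpace ℂ G] [CompleteSpace G]

/-- `(W₁, W₂)` is a `q`-commuting pair of isometries. -/
structure IsQIsometricPair (q : Circle) (W₁ W₂ : G →L[ℂ] G) : Prop where
  isometry₁ : Isometry W₁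
  isometry₂ : Isometry W₂
  q_commuting : IsQCommuting q W₁ W₂

namespace IsQIsometricPair

variable {q : Circle} {W₁ W₂ : G →L[ℂ] G} (hW : IsQIsometricPair q W₁ W₂)
include hW

theorem isometry_mul : Isometry (W₁ * W₂) := hW.isometry₁.comp hW.isometry₂

theorem comm (x : G) : W₁ (W₂ x) = (q : ℂ) • W₂ (W₁ x) := congr($(hW.q_commuting) x)

theorem adjoint_comm (x : G) :
    adjoint W₂ (adjoint W₁ x) = conj (q : ℂ) • adjoint W₁ (adjoint W₂ x) := by
  refine ext_inner_right ℂ fun y => ?_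
  rw [inner_smul_left, adjoint_inner_left, adjoint_inner_left, adjoint_inner_left,
    adjoint_inner_left, hW.comm, inner_smul_right, Complex.conj_conj]

omit hW in
theorem mem_wandering {x : G} : x ∈ wandering (W₁ * W₂) ↔ adjoint W₂ (adjoint W₁ x) = 0 := by
  rw [← show adjoint (W₁ * W₂) x = adjoint W₂ (adjoint W₁ x) from congr($(adjoint_comp W₁ W₂) x)]
  rfl

/-- `W₁ W₂` and `W₂ W₁` differ by a nonzero scalar, so their adjoints have the same kernel. -/
theorem mem_wandering' {x : G} :
    x ∈ wandering (W₁ * W₂) ↔ adjoint W₁ (adjoint W₂ x) = 0 := by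
  have hq : conj (q : ℂ) ≠ 0 := fun h => by simpa [h] using circle_mul_conj q
  rw [mem_wandering, hW.adjoint_comm, smul_eq_zero, or_iff_right hq]

/-- The orthogonal projection `1 - W₁ W₁*` of the wandering subspace of `W₁ W₂` onto that
of `W₁`. -/
def proj : wandering (W₁ * W₂) →L[ℂ] wandering (W₁ * W₂) :=
  ((1 - W₁ * adjoint W₁) ∘L (wandering (W₁ * W₂)).subtypeL).codRestrict _ fun x => by
    rw [mem_wandering]
    change adjoint W₂ (adjoint W₁ (x - W₁ (adjoint W₁ x))) = 0
    rw [sub_apply_adjoint_mem_wandering hW.isometry₁, map_zero]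

/-- The operator `q̄ (W₁ (1 - W₂ W₂*) + W₂*)` on the wandering subspace of `W₁ W₂`. -/
def unitaryCLM : wandering (W₁ * W₂) →L[ℂ] wandering (W₁ * W₂) :=
  ((conj (q : ℂ) • (W₁ * (1 - W₂ * adjoint W₂) + adjoint W₂)) ∘L
    (wandering (W₁ * W₂)).subtypeL).codRestrict _ fun x => by
    refine Submodule.smul_mem _ _ (mem_wandering.mpr ?_)
    change adjoint W₂ (adjoint W₁ (W₁ (x - W₂ (adjoint W₂ x)) + adjoint W₂ x)) = 0
    rw [map_add, hW.mem_wandering'.mp x.2, add_zero, adjoint_apply_of_isometry hW.isometry₁,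
      sub_apply_adjoint_mem_wandering hW.isometry₂]

/-- The operator `q (W₂ (1 - W₁ W₁*) + W₁*)` on the wandering subspace of `W₁ W₂`. -/
def unitaryInvCLM : wandering (W₁ * W₂) →L[ℂ] wandering (W₁ * W₂) :=
  (((q : ℂ) • (W₂ * (1 - W₁ * adjoint W₁) + adjoint W₁)) ∘L
    (wandering (W₁ * W₂)).subtypeL).codRestrict _ fun x => by
    refine Submodule.smul_mem _ _ (hW.mem_wandering'.mpr ?_)
    change adjoint W₁ (adjoint W₂ (W₂ (x - W₁ (adjoint W₁ x)) + adjoint W₁ x)) = 0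
    rw [map_add, mem_wandering.mp x.2, add_zero, adjoint_apply_of_isometry hW.isometry₂,
      sub_apply_adjoint_mem_wandering hW.isometry₁]

theorem coe_proj (x : wandering (W₁ * W₂)) : (hW.proj x : G) = x - W₁ (adjoint W₁ (x : G)) := rfl

theorem coe_unitaryCLM (x : wandering (W₁ * W₂)) : (hW.unitaryCLM x : G) =
    conj (q : ℂ) • (W₁ ((x : G) - W₂ (adjoint W₂ (x : G))) + adjoint W₂ (x : G)) := rfl

theorem coe_unitaryInvCLM (x : wandering (W₁ * W₂)) : (hW.unitaryInvCLM x : G) =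
    (q : ℂ) • (W₂ ((x : G) - W₁ (adjoint W₁ (x : G))) + adjoint W₁ (x : G)) := rfl

/-- The wandering subspace is both `ker W₂* ⊕ W₂ ker W₁*` and `W₁ ker W₂* ⊕ ker W₁*`. Up to the
scalar, the map applies `W₁` to the first summand and removes `W₂` from the second, and its inverse
undoes this. -/
theorem unitaryInvCLM_unitaryCLM (x : wandering (W₁ * W₂)) :
    hW.unitaryInvCLM (hW.unitaryCLM x) = x := by
  have h := hW.mem_wandering'.mp x.2
  ext1
  rw [coe_unitaryInvCLM, coe_unitaryCLM]
  simp only [map_smul, map_add, map_sub, h, adjoint_apply_of_isometry hW.isometry₁,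
    ← smul_sub, ← smul_add, smul_smul, circle_mul_conj, one_smul, map_zero]
  abel

theorem unitaryCLM_unitaryInvCLM (x : wandering (W₁ * W₂)) :
    hW.unitaryCLM (hW.unitaryInvCLM x) = x := by
  have h := mem_wandering.mp x.2
  ext1
  rw [coe_unitaryCLM, coe_unitaryInvCLM]
  simp only [map_smul, map_add, map_sub, h, adjoint_apply_of_isometry hW.isometry₂,
    ← smul_sub, ← smul_add, smul_smul, conj_mul_circle, one_smul, map_zero]
  abel

theorem norm_unitaryCLM (x : wandering (W₁ * W₂)) : ‖hW.unitaryCLM x‖ = ‖x‖ := by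
  have h1 := hW.mem_wandering'.mp x.2
  set y : G := x - W₂ (adjoint W₂ (x : G)) with hy
  have h2 : inner ℂ (W₁ y) (adjoint W₂ (x : G)) = 0 := by
    rw [← adjoint_inner_right, h1, inner_zero_right]
  have h3 : inner ℂ y (W₂ (adjoint W₂ (x : G))) = 0 :=
    inner_wandering (sub_apply_adjoint_mem_wandering hW.isometry₂ _) _
  have h4 := norm_add_sq_eq_norm_sq_add_norm_sq_of_inner_eq_zero _ _ h2
  have h5 := norm_add_sq_eq_norm_sq_add_norm_sq_of_inner_eq_zero _ _ h3
  rw [norm_apply_of_isometry hW.isometry₁] at h4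
  rw [norm_apply_of_isometry hW.isometry₂, hy, sub_add_cancel, ← hy, ← h4] at h5
  change ‖(hW.unitaryCLM x : G)‖ = ‖(x : G)‖
  rw [coe_unitaryCLM, norm_smul, RCLike.norm_conj, Circle.norm_coe, one_mul]
  exact (mul_self_inj (norm_nonneg _) (norm_nonneg _)).mp h5.symm

/-- The unitary operator `q̄ (W₁ (1 - W₂ W₂*) + W₂*)` on the wandering subspace of `W₁ W₂`. -/
def unitary : wandering (W₁ * W₂) ≃ₗᵢ[ℂ] wandering (W₁ * W₂) where
  toLinearEquiv := LinearEquiv.ofLinearMap hW.unitaryCLM.toLinearMap hW.unitaryInvCLM.toLinearMap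
    (LinearMap.ext hW.unitaryCLM_unitaryInvCLM) (LinearMap.ext hW.unitaryInvCLM_unitaryCLM)
  norm_map' := hW.norm_unitaryCLM

theorem coe_unitary (x : wandering (W₁ * W₂)) : (hW.unitary x : G) =
    conj (q : ℂ) • (W₁ ((x : G) - W₂ (adjoint W₂ (x : G))) + adjoint W₂ (x : G)) := rfl

theorem coe_unitary_symm (x : wandering (W₁ * W₂)) : (hW.unitary.symm x : G) =
    (q : ℂ) • (W₂ ((x : G) - W₁ (adjoint W₁ (x : G))) + adjoint W₁ (x : G)) := rfl

theorem isStarProjection_proj : IsStarProjection hW.proj := by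
  refine ⟨?_, ?_⟩
  · ext x
    change (hW.proj (hW.proj x) : G) = hW.proj x
    rw [coe_proj, coe_proj, sub_apply_adjoint_mem_wandering hW.isometry₁, map_zero, sub_zero]
  · refine (eq_adjoint_iff _ _).mpr (fun x y => ?_) |>.symm
    change inner ℂ ((x : G) - W₁ (adjoint W₁ (x : G))) (y : G) =
      inner ℂ (x : G) (y - W₁ (adjoint W₁ (y : G)))
    rw [inner_sub_left, inner_sub_right, ← adjoint_inner_right, ← adjoint_inner_left W₁]

theorem coe_proj_unitary (x : wandering (W₁ * W₂)) : (hW.proj (hW.unitary x) : G) =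
    conj (q : ℂ) • adjoint W₂ (x : G) := by
  rw [coe_proj, coe_unitary]
  simp only [map_smul, map_add, adjoint_apply_of_isometry hW.isometry₁,
    hW.mem_wandering'.mp x.2, add_zero, ← smul_sub, add_sub_cancel_left]

/-- Split `x` by `1 - W₂ W₂*` and `W₂ W₂*`: `W₁` of the first part is `q P^⊥ U x`, and `W₁ W₂ (W₂*
x)` is `q W P U x` since `P U = q̄ W₂*`. This reads off the symbol `(P^⊥ + zP)U`. -/
theorem apply₁_eq (x : wandering (W₁ * W₂)) : W₁ (x : G) = (q : ℂ) •
    (((hW.unitary x - hW.proj (hW.unitary x) : wandering (W₁ * W₂)) : G) +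
      (W₁ * W₂) (hW.proj (hW.unitary x) : G)) := by
  rw [Submodule.coe_sub, coe_proj_unitary, coe_unitary]
  change _ = (q : ℂ) • (_ + W₁ (W₂ _))
  simp only [map_smul, map_sub, ← smul_sub, ← smul_add, smul_smul, circle_mul_conj, one_smul]
  abel

theorem coe_unitary_symm_proj (x : wandering (W₁ * W₂)) :
    (hW.unitary.symm (hW.proj x) : G) = (q : ℂ) • W₂ ((x : G) - W₁ (adjoint W₁ (x : G))) := by
  rw [coe_unitary_symm, coe_proj, sub_apply_adjoint_mem_wandering hW.isometry₁, map_zero, sub_zero,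
    add_zero]

theorem coe_unitary_symm_sub_proj (x : wandering (W₁ * W₂)) :
    (hW.unitary.symm (x - hW.proj x) : G) = (q : ℂ) • adjoint W₁ (x : G) := by
  rw [map_sub, Submodule.coe_sub, coe_unitary_symm_proj, coe_unitary_symm, ← smul_sub,
    add_sub_cancel_left]

/-- Split `x` by `1 - W₁ W₁*` and `W₁ W₁*`. The outer `q̄` cancels the `q` in `U*`, the inner one
comes from `W₂ W₁ = q̄ W₁ W₂`. -/
theorem apply₂_eq (x : wandering (W₁ * W₂)) : W₂ (x : G) = conj (q : ℂ) •
    ((hW.unitary.symm (hW.proj x) : G) +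
      conj (q : ℂ) • (W₁ * W₂) (hW.unitary.symm (x - hW.proj x) : G)) := by
  rw [coe_unitary_symm_sub_proj, coe_unitary_symm_proj]
  change _ = conj (q : ℂ) • (_ + conj (q : ℂ) • W₁ (W₂ _))
  rw [hW.comm, map_smul, map_smul, map_sub, smul_smul, smul_smul, conj_mul_circle, one_mul,
    ← smul_add, smul_smul, conj_mul_circle, one_smul, sub_add_cancel]

theorem apply₁_mul (x : G) : W₁ ((W₁ * W₂) x) = (q : ℂ) • (W₁ * W₂) (W₁ x) := by
  change W₁ (W₁ (W₂ x)) = (q : ℂ) • W₁ (W₂ (W₁ x))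
  rw [hW.comm x, map_smul]

theorem apply₂_mul (x : G) : W₂ ((W₁ * W₂) x) = conj (q : ℂ) • (W₁ * W₂) (W₂ x) := by
  change W₂ (W₁ (W₂ x)) = conj (q : ℂ) • W₁ (W₂ (W₂ x))
  rw [hW.comm (W₂ x), smul_smul, conj_mul_circle, one_smul]

end IsQIsometricPair

end BergerCoburnLebow

/-! ### Isometric lifts of one contraction -/

section SingleLift

variable {H : Type u} [NormedAddCommGroup H] [InnerProductSpace ℂ H] [CompleteSpace H]
variable {K : Type v} [NormedAddCommGroup K] [InnerProductSpace ℂ K] [CompleteSpace K]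

/-- Equality of norms makes `D_T h ↦ B h` well defined and isometric on a dense subspace of the
defect space; it extends by continuity. -/
theorem exists_isometry_defectSpace {F : Type*} [NormedAddCommGroup F] [InnerProductSpace ℂ F]
    [CompleteSpace F] {T : H →L[ℂ] H} (B : H →L[ℂ] F) (hB : ∀ h, ‖B h‖ = ‖defectOp T h‖) :
    ∃ Λ : defectSpace T →ₗᵢ[ℂ] F, ∀ h, Λ (defectMap T h) = B h := by
  have hdense : DenseRange (defectMap T).toLinearMap := by
    intro x
    rw [closure_subtype]
    have h1 : Subtype.val '' Set.range (defectMap T).toLinearMap = Set.range (defectOp T) := by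
      rw [← Set.range_comp]; rfl
    rw [h1]
    exact x.2
  have hnorm : ∀ h, ‖B.toLinearMap h‖ ≤ 1 * ‖(defectMap T).toLinearMap h‖ := fun h => by
    rw [one_mul]; exact (hB h).le
  have hΛ : ∀ h, B.toLinearMap.extendOfNorm (defectMap T).toLinearMap (defectMap T h) = B h :=
    LinearMap.extendOfNorm_eq hdense ⟨1, hnorm⟩
  refine ⟨⟨(B.toLinearMap.extendOfNorm (defectMap T).toLinearMap).toLinearMap, fun x => ?_⟩, hΛ⟩
  refine hdense.induction (P := fun x =>
    ‖B.toLinearMap.extendOfNorm (defectMap T).toLinearMap x‖ = ‖x‖) ?_ ?_ x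
  · rintro _ ⟨h, rfl⟩
    exact (congrArg _ (hΛ h)).trans (hB h)
  · exact isClosed_eq (by fun_prop) (by fun_prop)

/-- The orthogonal complement of `H` in `K`, where `H` is embedded in `K` through `i`. -/
abbrev complement (i : H →ₗᵢ[ℂ] K) : Submodule ℂ K := (LinearMap.range i.toLinearMap)ᗮ

theorem mem_complement {i : H →ₗᵢ[ℂ] K} {x : K} :
    x ∈ complement i ↔ ∀ h, inner ℂ (i h) x = 0 := by
  rw [Submodule.mem_orthogonal]
  exact ⟨fun hx h => hx _ ⟨h, rfl⟩, by rintro hx _ ⟨h, rfl⟩; exact hx h⟩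

/-- The isometry `V` on `K` is a lift of `T` on `H`. -/
structure IsLift (i : H →ₗᵢ[ℂ] K) (T : H →L[ℂ] H) (V : K →L[ℂ] K) : Prop where
  isometry : Isometry V
  lift : ∀ h, adjoint V (i h) = i (adjoint T h)

namespace IsLift

variable {i : H →ₗᵢ[ℂ] K} {T : H →L[ℂ] H} {V : K →L[ℂ] K} (hV : IsLift i T V)
include hV

theorem mul {T' : H →L[ℂ] H} {V' : K →L[ℂ] K} (hV' : IsLift i T' V') :
    IsLift i (T * T') (V * V') where
  isometry := hV.isometry.comp hV'.isometry
  lift h := by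
    rw [show adjoint (V * V') = adjoint V' ∘L adjoint V from adjoint_comp _ _,
      show adjoint (T * T') = adjoint T' ∘L adjoint T from adjoint_comp _ _]
    change adjoint V' (adjoint V (i h)) = i (adjoint T' (adjoint T h))
    rw [hV.lift, hV'.lift]

/-- The restriction of a lift to the orthogonal complement of `H`. -/
def restr : complement i →L[ℂ] complement i :=
  (V ∘L (complement i).subtypeL).codRestrict _ fun x => mem_complement.mpr fun h => by
    change inner ℂ (i h) (V (x : K)) = 0
    rw [← adjoint_inner_left, hV.lift]
    exact mem_complement.mp x.2 _

theorem coe_restr (x : complement i) : (hV.restr x : K) = V x := rfl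

theorem isometry_restr : Isometry hV.restr :=
  AddMonoidHomClass.isometry_of_norm _ fun x => norm_apply_of_isometry hV.isometry (x : K)

/-- The operator `h ↦ V h - T h` from `H` to its orthogonal complement. -/
def offDiag : H →L[ℂ] complement i :=
  (V ∘L i.toContinuousLinearMap - i.toContinuousLinearMap ∘L T).codRestrict _ fun h =>
    mem_complement.mpr fun h' => by
      change inner ℂ (i h') (V (i h) - i (T h)) = 0
      rw [inner_sub_right, ← adjoint_inner_left, hV.lift, i.inner_map_map, i.inner_map_map,
        adjoint_inner_left, sub_self]

theorem coe_offDiag (h : H) : (hV.offDiag h : K) = V (i h) - i (T h) := rfl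

/-- For `x ⟂ H`, `V h ⟂ V x` because `V` is isometric, and `T h ⟂ V x` because `V` preserves the
complement. So the off-diagonal entry is wandering. -/
theorem adjoint_restr_offDiag (h : H) : adjoint hV.restr (hV.offDiag h) = 0 := by
  refine ext_inner_right ℂ fun x => ?_
  rw [adjoint_inner_left, inner_zero_left]
  change inner ℂ (V (i h) - i (T h)) (V (x : K)) = 0
  rw [inner_sub_left, inner_apply_of_isometry hV.isometry, mem_complement.mp x.2,
    ← hV.coe_restr, mem_complement.mp (hV.restr x).2 (T h), sub_zero]

/-- Pythagoras for `V h = T h + (V h - T h)`. -/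
theorem norm_offDiag_sq (h : H) : ‖T h‖ ^ 2 + ‖hV.offDiag h‖ ^ 2 = ‖h‖ ^ 2 := by
  have h1 := norm_add_sq_eq_norm_sq_add_norm_sq_of_inner_eq_zero _ _
    (mem_complement.mp (hV.offDiag h).2 (T h))
  rw [coe_offDiag, add_sub_cancel, norm_apply_of_isometry hV.isometry, i.norm_map, i.norm_map] at h1
  rw [sq, sq, sq, h1]
  rfl

theorem norm_offDiag (hT : ‖T‖ ≤ 1) (h : H) : ‖hV.offDiag h‖ = ‖defectOp T h‖ := by
  rw [← sq_eq_sq₀ (norm_nonneg _) (norm_nonneg _), norm_defectOp_sq hT, ← hV.norm_offDiag_sq]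
  ring

end IsLift

/-- The unitary `H ⊕ G → K`, `h ⊕ g ↦ i h + Φ g`, for a unitary `Φ` of `G` onto the orthogonal
complement of `H`. -/
def sumEquiv (i : H →ₗᵢ[ℂ] K) {G : Type v} [NormedAddCommGroup G] [InnerProductSpace ℂ G]
    (Φ : G ≃ₗᵢ[ℂ] complement i) : WithLp 2 (H × G) ≃ₗᵢ[ℂ] K :=
  LinearIsometryEquiv.ofSurjective
    { toFun := fun x => i x.fst + Φ x.snd
      map_add' := fun x y => by
        simp only [WithLp.add_fst, WithLp.add_snd, map_add, Submodule.coe_add]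
        abel
      map_smul' := fun c x => by
        simp only [WithLp.smul_fst, WithLp.smul_snd, map_smul, Submodule.coe_smul, smul_add,
          RingHom.id_apply]
      norm_map' := fun x => by
        have h1 := norm_add_sq_eq_norm_sq_add_norm_sq_of_inner_eq_zero _ _
          (mem_complement.mp (Φ x.snd).2 x.fst)
        rw [← sq_eq_sq₀ (norm_nonneg _) (norm_nonneg _), WithLp.prod_norm_sq_eq_of_L2]
        change ‖i x.fst + (Φ x.snd : K)‖ ^ 2 = _
        rw [sq, h1, i.norm_map, ← Submodule.coe_norm, Φ.norm_map, sq, sq] }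
    fun y => by
      have : CompleteSpace (LinearMap.range i.toLinearMap) :=
        i.isometry.isUniformInducing.isComplete_range.completeSpace_coe
      obtain ⟨_, ⟨h, rfl⟩, z, hz, rfl⟩ :=
        (LinearMap.range i.toLinearMap).exists_add_mem_mem_orthogonal y
      refine ⟨WithLp.toLp 2 (h, Φ.symm ⟨z, hz⟩), ?_⟩
      change i h + (Φ (Φ.symm ⟨z, hz⟩) : K) = i h + z
      rw [Φ.apply_symm_apply]

theorem sumEquiv_apply (i : H →ₗᵢ[ℂ] K) {G : Type v} [NormedAddCommGroup G]
    [InnerProductSpace ℂ G] (Φ : G ≃ₗᵢ[ℂ] complement i) (x : WithLp 2 (H × G)) :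
    sumEquiv i Φ x = i x.fst + Φ x.snd := rfl

theorem IsLift.sumEquiv_lowerBlock {i : H →ₗᵢ[ℂ] K} {T : H →L[ℂ] H} {V : K →L[ℂ] K}
    (hV : IsLift i T V) {G : Type v} [NormedAddCommGroup G] [InnerProductSpace ℂ G]
    (Φ : G ≃ₗᵢ[ℂ] complement i) {Y : H →L[ℂ] G} {Z : G →L[ℂ] G}
    (hY : ∀ h, Φ (Y h) = hV.offDiag h) (hZ : ∀ g, Φ (Z g) = hV.restr (Φ g))
    (x : WithLp 2 (H × G)) :
    sumEquiv i Φ (lowerBlock T Y Z x) = V (sumEquiv i Φ x) := by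
  rw [sumEquiv_apply, sumEquiv_apply]
  change i (T x.fst) + (Φ (Y x.fst + Z x.snd) : K) = _
  rw [map_add, hY, hZ, Submodule.coe_add, IsLift.coe_offDiag, IsLift.coe_restr, map_add]
  abel

end SingleLift

/-! ### The Andô tuple of a minimal lift -/

section PairLift

variable {H : Type u} [NormedAddCommGroup H] [InnerProductSpace ℂ H] [CompleteSpace H]
variable {K : Type v} [NormedAddCommGroup K] [InnerProductSpace ℂ K] [CompleteSpace K]

namespace IsIsometricLift

variable {q : Circle} {T₁ T₂ : H →L[ℂ] H} {i : H →ₗᵢ[ℂ] K} {V₁ V₂ : K →L[ℂ] K}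
  (hV : IsIsometricLift q T₁ T₂ i V₁ V₂)
include hV

theorem isLift₁ : IsLift i T₁ V₁ := ⟨hV.isometry₁, hV.lift₁⟩

theorem isLift₂ : IsLift i T₂ V₂ := ⟨hV.isometry₂, hV.lift₂⟩

theorem isLift_mul : IsLift i (T₁ * T₂) (V₁ * V₂) := hV.isLift₁.mul hV.isLift₂

theorem isQIsometricPair_restr : IsQIsometricPair q hV.isLift₁.restr hV.isLift₂.restr where
  isometry₁ := hV.isLift₁.isometry_restr
  isometry₂ := hV.isLift₂.isometry_restr
  q_commuting := by ext x; exact congr($(hV.q_commuting) x)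

theorem offDiag_mul (h : H) : hV.isLift_mul.offDiag h =
    hV.isLift₁.restr (hV.isLift₂.offDiag h) + hV.isLift₁.offDiag (T₂ h) := by
  ext1
  change V₁ (V₂ (i h)) - i (T₁ (T₂ h)) = V₁ (V₂ (i h) - i (T₂ h)) + (V₁ (i (T₂ h)) - i (T₁ (T₂ h)))
  rw [map_sub]
  abel

theorem offDiag_mul' (hT : IsQCommuting q T₁ T₂) (h : H) : hV.isLift_mul.offDiag h =
    (q : ℂ) • (hV.isLift₂.restr (hV.isLift₁.offDiag h) + hV.isLift₂.offDiag (T₁ h)) := by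
  ext1
  change V₁ (V₂ (i h)) - i (T₁ (T₂ h)) =
    (q : ℂ) • (V₂ (V₁ (i h) - i (T₁ h)) + (V₂ (i (T₁ h)) - i (T₂ (T₁ h))))
  rw [show V₁ (V₂ (i h)) = (q : ℂ) • V₂ (V₁ (i h)) from congr($(hV.q_commuting) (i h)),
    show T₁ (T₂ h) = (q : ℂ) • T₂ (T₁ h) from congr($hT h), map_smul, ← smul_sub, map_sub]
  congr 1
  abel

/-- In the expansion of the off-diagonal entry of `V₁ V₂`, one term is in the range of `W₁` and the
other in `ker W₁*`. -/
theorem adjoint_restr₁_offDiag_mul (h : H) :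
    adjoint hV.isLift₁.restr (hV.isLift_mul.offDiag h) = hV.isLift₂.offDiag h := by
  rw [hV.offDiag_mul, map_add, adjoint_apply_of_isometry hV.isLift₁.isometry_restr,
    IsLift.adjoint_restr_offDiag, add_zero]

theorem adjoint_restr₂_offDiag_mul (hT : IsQCommuting q T₁ T₂) (h : H) :
    adjoint hV.isLift₂.restr (hV.isLift_mul.offDiag h) = (q : ℂ) • hV.isLift₁.offDiag h := by
  rw [hV.offDiag_mul' hT, map_smul, map_add, adjoint_apply_of_isometry hV.isLift₂.isometry_restr,
    IsLift.adjoint_restr_offDiag, add_zero]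

/-- The restriction of `V₁ V₂` to the orthogonal complement of `H` is pure if the lift is
minimal. -/
theorem isPure_restr (hmin : IsMinimalLift i V₁ V₂) :
    IsPure (hV.isLift₁.restr * hV.isLift₂.restr) := by
  set W₁ := hV.isLift₁.restr with hW₁
  set W₂ := hV.isLift₂.restr with hW₂
  have hW : IsQIsometricPair q W₁ W₂ := hV.isQIsometricPair_restr
  -- `N` is the intersection of the ranges of `Wⁿ`, seen in `K`. Being orthogonal to `H` and
  -- invariant under `V₁*` and `V₂*`, it is orthogonal to every `V₁ᵐ V₂ⁿ h`, hence zero by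
  -- minimality.
  set N : Set K := {x | ∃ g : complement i, (g : K) = x ∧ ∀ n : ℕ, ∃ y, ((W₁ * W₂) ^ n) y = g}
  have hpow : ∀ (c : ℂ) (V : complement i →L[ℂ] complement i),
      (∀ x, V ((W₁ * W₂) x) = c • (W₁ * W₂) (V x)) →
      ∀ (n : ℕ) x, V (((W₁ * W₂) ^ n) x) = ((W₁ * W₂) ^ n) (c ^ n • V x) := by
    intro c V hc n
    induction n with
    | zero => simp
    | succ n ih =>
      intro x
      rw [pow_succ (W₁ * W₂)]
      change V (((W₁ * W₂) ^ n) ((W₁ * W₂) x)) = ((W₁ * W₂) ^ n) ((W₁ * W₂) (c ^ (n + 1) • V x))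
      rw [ih, hc, map_smul (W₁ * W₂), smul_smul, pow_succ]
  have hinv : ∀ (c : ℂ) (V : complement i →L[ℂ] complement i),
      (∀ x, V ((W₁ * W₂) x) = c • (W₁ * W₂) (V x)) → ∀ g : complement i,
      (∀ n : ℕ, ∃ y, ((W₁ * W₂) ^ n) y = g) → ∀ n : ℕ, ∃ y, ((W₁ * W₂) ^ n) y = V g := by
    intro c V hc g hg n
    obtain ⟨y, hy⟩ := hg n
    exact ⟨c ^ n • V y, by rw [← hpow c V hc, hy]⟩
  -- Each element of `N` is `W₁ W₂ y` with `y` in `N`, so `V₁*` and `V₂*` only strip a factor and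
  -- reduce to `W₂` and `q W₁` acting on `y`.
  have hroot : ∀ g : complement i, (∀ n : ℕ, ∃ y, ((W₁ * W₂) ^ n) y = g) →
      ∃ y, W₁ (W₂ y) = g ∧ ∀ n : ℕ, ∃ z, ((W₁ * W₂) ^ n) z = y := by
    intro g hg
    obtain ⟨y, hy⟩ := hg 1
    rw [pow_one] at hy
    refine ⟨y, hy, fun n => ?_⟩
    obtain ⟨z, hz⟩ := hg (n + 1)
    refine ⟨z, hW.isometry_mul.injective ?_⟩
    rw [hy, ← hz, pow_succ']
    rfl
  have hN₁ : ∀ x ∈ N, adjoint V₁ x ∈ N := by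
    rintro _ ⟨g, rfl, hg⟩
    obtain ⟨y, hy, hy'⟩ := hroot g hg
    refine ⟨W₂ y, ?_, hinv _ W₂ hW.apply₂_mul y hy'⟩
    rw [← hy]
    exact (adjoint_apply_of_isometry hV.isometry₁ _).symm
  have hN₂ : ∀ x ∈ N, adjoint V₂ x ∈ N := by
    rintro _ ⟨g, rfl, hg⟩
    obtain ⟨y, hy, hy'⟩ := hroot g hg
    refine ⟨(q : ℂ) • W₁ y, ?_, fun n => ?_⟩
    · rw [← hy, show W₁ (W₂ y) = W₂ ((q : ℂ) • W₁ y) by rw [hW.comm, map_smul]]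
      exact (adjoint_apply_of_isometry hV.isometry₂ _).symm
    · obtain ⟨z, hz⟩ := hinv _ W₁ hW.apply₁_mul y hy' n
      exact ⟨(q : ℂ) • z, by rw [map_smul, hz]⟩
  have hpowN : ∀ V : K →L[ℂ] K, (∀ x ∈ N, adjoint V x ∈ N) → ∀ (n : ℕ), ∀ x ∈ N, ∀ y,
      ∃ x' ∈ N, inner ℂ x ((V ^ n) y) = inner ℂ x' y := by
    intro V hVN n
    induction n with
    | zero => exact fun x hx y => ⟨x, hx, rfl⟩
    | succ n ih =>
      intro x hx y
      obtain ⟨x', hx', h⟩ := ih (adjoint V x) (hVN x hx) y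
      refine ⟨x', hx', ?_⟩
      rw [← h, pow_succ', adjoint_inner_left]
      rfl
  intro g hg
  have hspan : ∀ y ∈ Submodule.span ℂ
      {x : K | ∃ (m n : ℕ) (h : H), x = (V₁ ^ m) ((V₂ ^ n) (i h))}, inner ℂ (g : K) y = 0 := by
    intro y hy
    induction hy using Submodule.span_induction with
    | mem y hy =>
      obtain ⟨m, n, h, rfl⟩ := hy
      obtain ⟨x, hx, h1⟩ := hpowN V₁ hN₁ m g ⟨g, rfl, hg⟩ ((V₂ ^ n) (i h))
      obtain ⟨_, ⟨x', rfl, -⟩, h2⟩ := hpowN V₂ hN₂ n x hx (i h)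
      rw [h1, h2, ← inner_conj_symm, mem_complement.mp x'.2, map_zero]
    | zero => exact inner_zero_right _
    | add x y _ _ hx hy => rw [inner_add_right, hx, hy, add_zero]
    | smul c x _ hx => rw [inner_smul_right, hx, mul_zero]
  have hperp : (g : K) ∈ (Submodule.span ℂ
      {x : K | ∃ (m n : ℕ) (h : H), x = (V₁ ^ m) ((V₂ ^ n) (i h))})ᗮ :=
    (Submodule.mem_orthogonal' _ _).mpr hspan
  rw [Submodule.topologicalClosure_eq_top_iff.mp hmin, Submodule.mem_bot] at hperp
  exact Subtype.ext hperp

theorem sumEquiv_schaffer₁ {F : Type v} [NormedAddCommGroup F] [InnerProductSpace ℂ F]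
    [CompleteSpace F] (A : AndoTuple T₁ T₂ F) (Φ : Hardy F ≃ₗᵢ[ℂ] complement i)
    (hY : ∀ h, Φ (adjoint Hardy.ev0 (A.P (A.U (A.ΛD h)))) = hV.isLift₁.offDiag h)
    (hZ : ∀ f, Φ ((q : ℂ) • Hardy.mulPencil (A.Pperp ∘L A.Uop) (A.P ∘L A.Uop)
      (Hardy.rotation q f)) = hV.isLift₁.restr (Φ f)) (x : WithLp 2 (H × Hardy F)) :
    sumEquiv i Φ (schaffer₁ q A x) = V₁ (sumEquiv i Φ x) :=
  hV.isLift₁.sumEquiv_lowerBlock Φ hY hZ x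

theorem sumEquiv_schaffer₂ {F : Type v} [NormedAddCommGroup F] [InnerProductSpace ℂ F]
    [CompleteSpace F] (A : AndoTuple T₁ T₂ F) (Φ : Hardy F ≃ₗᵢ[ℂ] complement i)
    (hY : ∀ h, Φ (conj (q : ℂ) • adjoint Hardy.ev0 (adjoint A.Uop (A.Pperp (A.ΛD h)))) =
      hV.isLift₂.offDiag h)
    (hZ : ∀ f, Φ (conj (q : ℂ) • Hardy.rotation q⁻¹
      (Hardy.mulPencil (A.U.symm.toLinearIsometry.toContinuousLinearMap ∘L A.P)
        (A.U.symm.toLinearIsometry.toContinuousLinearMap ∘L A.Pperp) f)) =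
        hV.isLift₂.restr (Φ f)) (x : WithLp 2 (H × Hardy F)) :
    sumEquiv i Φ (schaffer₂ q A x) = V₂ (sumEquiv i Φ x) := by
  rw [← A.adjoint_Uop] at hZ
  exact hV.isLift₂.sumEquiv_lowerBlock Φ hY hZ x

/-- The operator `h ↦ V₁ V₂ h - T₁ T₂ h`, with values in the wandering subspace of the restriction
of `V₁ V₂` to the orthogonal complement of `H`. -/
def offDiagWandering : H →L[ℂ] wandering (hV.isLift₁.restr * hV.isLift₂.restr) :=
  hV.isLift_mul.offDiag.codRestrict _ fun h => hV.isLift_mul.adjoint_restr_offDiag h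

theorem exists_isometry_offDiagWandering (hT₁₂ : ‖T₁ * T₂‖ ≤ 1) :
    ∃ Λ : defectSpace (T₁ * T₂) →ₗᵢ[ℂ] wandering (hV.isLift₁.restr * hV.isLift₂.restr),
      ∀ h, Λ (defectMap (T₁ * T₂) h) = hV.offDiagWandering h :=
  exists_isometry_defectSpace hV.offDiagWandering (hV.isLift_mul.norm_offDiag hT₁₂)

/-- The Andô tuple of an isometric lift. -/
def andoTuple (hT₁₂ : ‖T₁ * T₂‖ ≤ 1) :
    AndoTuple T₁ T₂ (wandering (hV.isLift₁.restr * hV.isLift₂.restr)) where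
  Λ := (hV.exists_isometry_offDiagWandering hT₁₂).choose
  P := hV.isQIsometricPair_restr.proj
  isStarProjection_P := hV.isQIsometricPair_restr.isStarProjection_proj
  U := hV.isQIsometricPair_restr.unitary

variable (hT : IsQCommuting q T₁ T₂) (hT₁₂ : ‖T₁ * T₂‖ ≤ 1)

theorem coe_andoTuple_ΛD (h : H) :
    ((hV.andoTuple hT₁₂).ΛD h : complement i) = hV.isLift_mul.offDiag h :=
  congrArg Subtype.val ((hV.exists_isometry_offDiagWandering hT₁₂).choose_spec h)

-- On the wandering subspace `P U = q̄ W₂*`, and `W₂*` sends the off-diagonal entry of `V₁ V₂` to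
-- `q` times that of `V₁`.
include hT in
theorem coe_andoTuple_P_U_ΛD (h : H) :
    ((hV.andoTuple hT₁₂).P ((hV.andoTuple hT₁₂).U ((hV.andoTuple hT₁₂).ΛD h)) : complement i) =
      hV.isLift₁.offDiag h := by
  refine (hV.isQIsometricPair_restr.coe_proj_unitary ((hV.andoTuple hT₁₂).ΛD h)).trans ?_
  rw [coe_andoTuple_ΛD, hV.adjoint_restr₂_offDiag_mul hT, smul_smul, conj_mul_circle, one_smul]

theorem coe_andoTuple_Pperp_ΛD (h : H) :
    ((hV.andoTuple hT₁₂).Pperp ((hV.andoTuple hT₁₂).ΛD h) : complement i) =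
      hV.isLift₁.restr (hV.isLift₂.offDiag h) := by
  change ((hV.andoTuple hT₁₂).ΛD h : complement i) -
    (hV.isQIsometricPair_restr.proj ((hV.andoTuple hT₁₂).ΛD h) : complement i) = _
  rw [IsQIsometricPair.coe_proj, sub_sub_cancel, coe_andoTuple_ΛD, hV.adjoint_restr₁_offDiag_mul]

theorem coe_andoTuple_adjoint_U_Pperp_ΛD (h : H) :
    (adjoint (hV.andoTuple hT₁₂).Uop ((hV.andoTuple hT₁₂).Pperp ((hV.andoTuple hT₁₂).ΛD h)) :
      complement i) = (q : ℂ) • hV.isLift₂.offDiag h := by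
  rw [AndoTuple.adjoint_Uop_apply]
  refine (hV.isQIsometricPair_restr.coe_unitary_symm_sub_proj ((hV.andoTuple hT₁₂).ΛD h)).trans ?_
  rw [coe_andoTuple_ΛD, hV.adjoint_restr₁_offDiag_mul]

-- The norm identities are Pythagoras for `V₁` and `V₂`; the decompositions are the two expansions
-- of the off-diagonal entry, as `V₁ V₂` and as `q V₂ V₁`.
include hT in
theorem andoTuple_vectorRelations : (hV.andoTuple hT₁₂).VectorRelations := by
  have hW := hV.isQIsometricPair_restr
  refine ⟨fun h => ?_, fun h => ?_, fun h => ?_, fun h => ?_⟩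
  · rw [← hV.isLift₁.norm_offDiag_sq h, ← hV.coe_andoTuple_P_U_ΛD hT hT₁₂]
    rfl
  · rw [← hV.isLift₂.norm_offDiag_sq h, ← norm_apply_of_isometry hW.isometry₁,
      ← hV.coe_andoTuple_Pperp_ΛD hT₁₂]
    rfl
  · ext1
    rw [Submodule.coe_add, coe_andoTuple_P_U_ΛD hV hT, coe_andoTuple_Pperp_ΛD, coe_andoTuple_ΛD,
      hV.offDiag_mul, add_comm]
  · ext1
    rw [Submodule.coe_add, coe_andoTuple_P_U_ΛD hV hT, coe_andoTuple_Pperp_ΛD]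
    refine (hW.coe_unitary ((hV.andoTuple hT₁₂).ΛD h)).trans ?_
    rw [coe_andoTuple_ΛD, hV.adjoint_restr₂_offDiag_mul hT, hV.offDiag_mul' hT, map_smul,
      ← smul_sub, add_sub_cancel_left, map_smul, ← smul_add, smul_smul, conj_mul_circle, one_smul]

/-- The identification of the orthogonal complement of `H` in the space of a minimal lift with a
Hardy space. -/
def hardyEquiv (hmin : IsMinimalLift i V₁ V₂) :
    Hardy (wandering (hV.isLift₁.restr * hV.isLift₂.restr)) ≃ₗᵢ[ℂ] complement i :=
  (woldEquiv hV.isQIsometricPair_restr.isometry_mul (hV.isPure_restr hmin)).symm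

variable (hmin : IsMinimalLift i V₁ V₂)

theorem hardyEquiv_adjoint_ev0 (a : wandering (hV.isLift₁.restr * hV.isLift₂.restr)) :
    hV.hardyEquiv hmin (adjoint Hardy.ev0 a) = a := by
  rw [Hardy.adjoint_ev0_apply]
  exact woldEquiv_symm_single hV.isQIsometricPair_restr.isometry_mul (hV.isPure_restr hmin) 0 a

include hT in
theorem sumEquiv_andoTuple₁ (x) :
    sumEquiv i (hV.hardyEquiv hmin) (schaffer₁ q (hV.andoTuple hT₁₂) x) =
      V₁ (sumEquiv i (hV.hardyEquiv hmin) x) := by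
  have hW := hV.isQIsometricPair_restr
  refine hV.sumEquiv_schaffer₁ _ _ (fun h => ?_) (fun f => ?_) x
  · rw [hardyEquiv_adjoint_ev0, coe_andoTuple_P_U_ΛD hV hT]
  · exact woldEquiv_symm_mulPencil_rotation hW.isometry_mul (hV.isPure_restr hmin) hW.apply₁_mul
      (X := (hV.andoTuple hT₁₂).Pperp ∘L (hV.andoTuple hT₁₂).Uop)
      (Y := (hV.andoTuple hT₁₂).P ∘L (hV.andoTuple hT₁₂).Uop) (fun a => hW.apply₁_eq a) f

theorem sumEquiv_andoTuple₂ (x) :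
    sumEquiv i (hV.hardyEquiv hmin) (schaffer₂ q (hV.andoTuple hT₁₂) x) =
      V₂ (sumEquiv i (hV.hardyEquiv hmin) x) := by
  have hW := hV.isQIsometricPair_restr
  refine hV.sumEquiv_schaffer₂ _ _ (fun h => ?_) (fun f => ?_) x
  · rw [map_smul, hardyEquiv_adjoint_ev0, coe_andoTuple_adjoint_U_Pperp_ΛD, smul_smul,
      conj_mul_circle, one_smul]
  · exact woldEquiv_symm_rotation_mulPencil hW.isometry_mul (hV.isPure_restr hmin) hW.apply₂_mul
      (X := (hV.andoTuple hT₁₂).U.symm.toLinearIsometry.toContinuousLinearMap ∘L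
        (hV.andoTuple hT₁₂).P)
      (Y := (hV.andoTuple hT₁₂).U.symm.toLinearIsometry.toContinuousLinearMap ∘L
        (hV.andoTuple hT₁₂).Pperp) (fun a => hW.apply₂_eq a) f

end IsIsometricLift

end PairLift

end QCommuting

end

/-! ### Both directions of the theorem -/

open QCommuting in
theorem theoremT {H : Type u} [NormedAddCommGroup H] [InnerProductSpace ℂ H] [CompleteSpace H]
    (q : Circle) (T₁ T₂ : H →L[ℂ] H) (hT₁ : ‖T₁‖ ≤ 1) (hT₂ : ‖T₂‖ ≤ 1)
    (hT : IsQCommuting q T₁ T₂) :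
    (∀ (E : Type w) [NormedAddCommGroup E] [InnerProductSpace ℂ E] [CompleteSpace E]
        (A : AndoTuple T₁ T₂ (AndoSpace T₁ T₂ E)), A.IsSpecial →
        IsIsometricLift q T₁ T₂ (inclusion H (Hardy (AndoSpace T₁ T₂ E)))
            (schaffer₁ q A) (schaffer₂ q A) ∧
          A.Relations) ∧
    (∀ (K : Type v) [NormedAddCommGroup K] [InnerProductSpace ℂ K] [CompleteSpace K]
        (i : H →ₗᵢ[ℂ] K) (V₁ V₂ : K →L[ℂ] K),
        IsIsometricLift q T₁ T₂ i V₁ V₂ → IsMinimalLift i V₁ V₂ →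
        ∃ (F : Type v) (_ : NormedAddCommGroup F) (_ : InnerProductSpace ℂ F)
          (_ : CompleteSpace F) (A : AndoTuple T₁ T₂ F),
          A.Relations ∧
          ∃ τ : K ≃ₗᵢ[ℂ] WithLp 2 (H × Hardy F),
            (∀ h, τ (i h) = inclusion H (Hardy F) h) ∧
            (∀ x, τ (V₁ x) = schaffer₁ q A (τ x)) ∧
            (∀ x, τ (V₂ x) = schaffer₂ q A (τ x))) := by
  refine ⟨fun E _ _ _ A hA => ?_, fun K _ _ _ i V₁ V₂ hV hmin => ?_⟩
  · have h := hA.vectorRelations hT₁ hT₂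
    exact ⟨h.isIsometricLift hT, h.relations⟩
  · have hT₁₂ : ‖T₁ * T₂‖ ≤ 1 :=
      (norm_mul_le _ _).trans (mul_le_one₀ hT₁ (norm_nonneg _) hT₂)
    refine ⟨_, inferInstance, inferInstance, inferInstance, hV.andoTuple hT₁₂,
      (hV.andoTuple_vectorRelations hT hT₁₂).relations,
      (sumEquiv i (hV.hardyEquiv hmin)).symm, fun h => ?_, fun x => ?_, fun x => ?_⟩
    · rw [LinearIsometryEquiv.symm_apply_eq, sumEquiv_apply, inclusion_apply]
      simp
    · rw [LinearIsometryEquiv.symm_apply_eq, hV.sumEquiv_andoTuple₁ hT,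
        LinearIsometryEquiv.apply_symm_apply]
    · rw [LinearIsometryEquiv.symm_apply_eq, hV.sumEquiv_andoTuple₂,
        LinearIsometryEquiv.apply_symm_apply]
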